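/- Notation. For $\omega$ in the upper half-plane $\mathbb H$ let $\Delta(\omega)=g_2(\omega)^3-27g_3(\omega)^2=(2\pi)^{12}\eta(\omega)^{24}$, let $j(\omega)=1728\,g_2(\omega)^3/\Delta(\omega)$, and for $\operatorname{Im}(\omega_1/\omega_2)>0$ put $\Delta(\omega_1,\omega_2)=\omega_2^{-12}\Delta(\omega_1/\omega_2)$. For an integral $2\times 2$ matrix $S$ of determinant $s>0$ let $$\varphi_S(\omega)=s^{12}\,\frac{\Delta\bigl(S\binom{\omega_1}{\omega_2}\bigr)}{\Delta\binom{\omega_1}{\omega_2}},\qquad \omega=\omega_1/\omega_2 .$$ Two such matrices $S,S'$ are called equivalent if $S'=MS$ with $M\in \mathrm{SL}_2(\mathbb Z)$. Let $p$ be a prime number and $P$ an integral matrix of determinant $p$. An entire integral function $f=f_P$ from $\mathbb Q_{\mathfrak M_P}=\mathbb Q(j(\omega),j(P(\omega)))$ is an element $f$ of this field of meromorphic functions that is holomorphic on $\mathbb H$ and such that all conjugates $f_S$ have $q$-expansions (with finitely many negative exponents, in powers of $q^{1/p}=e^{2\pi i\omega/p}$) whose coefficients are algebraic integers. Here, for an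 integral matrix $S$ of determinant $p$, the conjugate is $f_S(\omega)=f(M(\omega))$ for any $M\in\mathrm{SL}_2(\mathbb Z)\cap P^{-1}\mathrm{SL}_2(\mathbb Z)S$. Setting. Let $\Sigma\subset\mathbb C$ be an imaginary quadratic field with ring of integers $\mathcal O_\Sigma$, and let $p$ be a prime number with $p\,\mathcal O_\Sigma=\mathfrak p\,\bar{\mathfrak p}$ for two (equal or distinct) prime ideals $\mathfrak p,\bar{\mathfrak p}$. Let $R$ be an order of $\Sigma$ whose conductor is not divisible by $p$, and put $\mathfrak p_R=\mathfrak p\cap R$, $\bar{\mathfrak p}_R=\bar{\mathfrak p}\cap R$. Let $\alpha_1,\alpha_2$ be a $\mathbb Z$-basis of a (not necessarily integral) ideal $\mathfrak a_R$ of $R$ such that $\alpha=\alpha_1/\alpha_2$ has positive imaginary part. Theorem. 1. There is an integral matrix $P_{\mathfrak p}$ of determinant $p$, uniquely determined up to equivalence, for which $P_{\mathfrak p}\binom{\alpha_1}{\alpha_2}$ is a basis of $\mathfrak a_R\,\mathfrak p_R$. For every such matrix $\varphi_{P_{\mathfrak p}}(\alpha)\approx\bar{\mathfrak p}^{12}$,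 that is, $\varphi_{P_{\mathfrak p}}(\alpha)$ is an algebraic integer that generates the same ideal as $\bar{\mathfrak p}^{12}$ in the ring of all algebraic integers. 2. Suppose $\mathfrak p\neq\bar{\mathfrak p}$, and let $P_{\bar{\mathfrak p}}$ be an integral matrix of determinant $p$ for which $P_{\bar{\mathfrak p}}\binom{\alpha_1}{\alpha_2}$ is a basis of $\mathfrak a_R\,\bar{\mathfrak p}_R$. Let $f_P$ be an entire integral function from $\mathbb Q_{\mathfrak M_P}$, where $P$ is an integral matrix of determinant $p$, and suppose that the coefficients of the $q$-expansion of the conjugate $f_{\left(\begin{smallmatrix}p&0\\0&1\end{smallmatrix}\right)}$ are divisible by $p$. Then the complex number $f_{P_{\bar{\mathfrak p}}}(\alpha)$ is algebraic and divisible by $\mathfrak p$, that is, it is an algebraic integer lying in the ideal generated by $\mathfrak p$ in the ring of all algebraic integers. -/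

import Mathlib

open scoped NumberField MatrixGroups Manifold Matrix

noncomputable section

namespace CM

open UpperHalfPlane

/-! ### Modular functions -/

/-- The fractional linear transformation `S(ω) = (aω + b)/(cω + d)` of the upper half-plane given
by an integer matrix `S`. It is meant for `det S > 0` only, see `coe_moebius`. -/
def moebius (S : Matrix (Fin 2) (Fin 2) ℤ) (z : ℍ) : ℍ :=
  ofComplex (((S 0 0 : ℂ) * z + S 0 1) / ((S 1 0 : ℂ) * z + S 1 1))

lemma coe_moebius (S : Matrix (Fin 2) (Fin 2) ℤ) (hS : 0 < S.det) (z : ℍ) :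
    (moebius S z : ℂ) = ((S 0 0 : ℂ) * z + S 0 1) / ((S 1 0 : ℂ) * z + S 1 1) := by
  have hd : (0 : ℝ) < (S.map (Int.cast : ℤ → ℝ)).det := by
    have h : (S.map (Int.cast : ℤ → ℝ)).det = (S.det : ℝ) := by
      simp [Matrix.det_fin_two]
    rw [h]
    exact_mod_cast hS
  have hg := coe_smul_of_det_pos
    (g := Matrix.GeneralLinearGroup.mkOfDetNeZero (S.map (Int.cast : ℤ → ℝ)) hd.ne')
    (by simpa using hd) z
  have hw : ((Matrix.GeneralLinearGroup.mkOfDetNeZero (S.map (Int.cast : ℤ → ℝ)) hd.ne' • z : ℍ) : ℂ)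
      = ((S 0 0 : ℂ) * z + S 0 1) / ((S 1 0 : ℂ) * z + S 1 1) := by
    rw [hg]
    simp [num, denom, Matrix.GeneralLinearGroup.mkOfDetNeZero]
  rw [moebius, ← hw, ofComplex_apply]

/-- The homogeneous discriminant `Δ(ω₁, ω₂) = ω₂⁻¹² Δ(ω₁/ω₂)` for `Im (ω₁/ω₂) > 0`, where
`Δ(ω) = g₂(ω)³ - 27 g₃(ω)² = (2π)¹² η(ω)²⁴`. -/
def deltaHom (w₁ w₂ : ℂ) : ℂ :=
  (2 * Real.pi : ℂ) ^ 12 * ModularForm.eta (w₁ / w₂) ^ 24 / w₂ ^ 12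

/-- `φ_S(ω) = s¹² Δ(S(ω₁, ω₂)) / Δ(ω₁, ω₂)` with `s = det S` and `ω = ω₁/ω₂`; the quotient does not
depend on the choice of `ω₁, ω₂`, and we take `ω₁ = ω`, `ω₂ = 1`. -/
def phi (S : Matrix (Fin 2) (Fin 2) ℤ) (z : ℍ) : ℂ :=
  (S.det : ℂ) ^ 12 * deltaHom ((S 0 0 : ℂ) * z + S 0 1) ((S 1 0 : ℂ) * z + S 1 1) / deltaHom z 1

/-- The absolute invariant `j = 1728 g₂³/(g₂³ - 27 g₃²) = E₄³/η²⁴`; here `ModularForm.discriminant = η²⁴`. -/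
def j (z : ℍ) : ℂ := ModularForm.E₄ z ^ 3 / ModularForm.discriminant z

/-- A holomorphic function `f` on the upper half-plane belongs to the field `ℚ(j(ω), j(P(ω)))`, as a
meromorphic function: `f = A(j, j∘P) / B(j, j∘P)` for polynomials `A, B` over `ℚ` with
`B(j, j∘P)` not identically zero. -/
def MemRationalField (P : Matrix (Fin 2) (Fin 2) ℤ) (f : ℍ → ℂ) : Prop :=
  ∃ A B : MvPolynomial (Fin 2) ℚ,
    (∃ z : ℍ, MvPolynomial.aeval ![j z, j (moebius P z)] B ≠ 0) ∧
    ∀ z : ℍ, f z * MvPolynomial.aeval ![j z, j (moebius P z)] B =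
      MvPolynomial.aeval ![j z, j (moebius P z)] A

/-- `g = f_S` is the conjugate, indexed by the matrix `S`, of a function `f = f_P` for the group
`SL₂(ℤ) ∩ P⁻¹ SL₂(ℤ) P`: one has `g(ω) = f(M(ω))` with `M ∈ SL₂(ℤ) ∩ P⁻¹ SL₂(ℤ) S`. -/
def IsConjugate (P : Matrix (Fin 2) (Fin 2) ℤ) (f : ℍ → ℂ) (S : Matrix (Fin 2) (Fin 2) ℤ)
    (g : ℍ → ℂ) : Prop :=
  ∃ M N : SL(2, ℤ), P * (M : Matrix (Fin 2) (Fin 2) ℤ) = (N : Matrix (Fin 2) (Fin 2) ℤ) * S ∧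
    ∀ z : ℍ, g z = f (M • z)

/-- In some half-plane `Im ω > ρ` one has `g(ω) = ∑ a_ν q^{ν/h}`, `q^{1/h} = exp(2πiω/h)`, with only
finitely many nonzero coefficients of negative index. -/
def HasQExpansion (h : ℕ) (g : ℍ → ℂ) (a : ℤ → ℂ) : Prop :=
  (∃ n : ℤ, ∀ ν < n, a ν = 0) ∧
  ∃ ρ : ℝ, ∀ z : ℍ, ρ < z.im →
    HasSum (fun ν : ℤ => a ν * Function.Periodic.qParam (h : ℝ) (z : ℂ) ^ ν) (g z)

/-- Entire integral functions `f = f_P` from `ℚ(j(ω), j(P(ω)))`, for `P` of determinant `p`: `f` is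
holomorphic on the upper half-plane, and all its conjugates have `q`-expansions (in `q^{1/p}`)
whose coefficients are algebraic integers. -/
structure IsEntireIntegral (p : ℕ) (P : Matrix (Fin 2) (Fin 2) ℤ) (f : ℍ → ℂ) : Prop where
  holomorphic : MDifferentiable 𝓘(ℂ) 𝓘(ℂ) f
  mem : MemRationalField P f
  integral : ∀ S g, IsConjugate P f S g →
    ∃ a : ℤ → ℂ, HasQExpansion p g a ∧ ∀ ν, IsIntegral ℤ (a ν)

/-! ### Orders and their ideals -/

section Orders

variable {K : Type*} [Field K]

/-- Orders of a number field `K`: subrings of the maximal order `𝓞 K` that span `K` over `ℚ`. -/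
def IsOrder [CharZero K] (R : Subalgebra ℤ (𝓞 K)) : Prop :=
  Submodule.span ℚ ((fun x : 𝓞 K => (x : K)) '' (R : Set (𝓞 K))) = ⊤

/-- The conductor of `R`: the elements `x` with `x 𝓞 ⊆ R`, an ideal of the maximal order `𝓞`. -/
def conductor (R : Subalgebra ℤ (𝓞 K)) : Ideal (𝓞 K) where
  carrier := {x | ∀ y : 𝓞 K, x * y ∈ R}
  add_mem' {a b} ha hb y := by
    rw [add_mul]
    exact R.add_mem (ha y) (hb y)
  zero_mem' y := by
    rw [zero_mul]
    exact R.zero_mem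
  smul_mem' c x hx y := by
    rw [smul_eq_mul, mul_comm c x, mul_assoc]
    exact hx (c * y)

/-- The ideal `𝔭_R = 𝔭 ∩ R` of the order `R` associated to an integral ideal `𝔭` of the maximal order
(it is used only for `𝔭` prime to the conductor of `R`). -/
def idealIn (R : Subalgebra ℤ (𝓞 K)) (𝔭 : Ideal (𝓞 K)) : Ideal R :=
  𝔭.comap R.val.toRingHom

/-- `v 0, v 1` is a `ℤ`-basis of the ideal `𝔞` of `R`; ideals of `R` need not be integral. -/
def IsBasisOf {R : Subalgebra ℤ (𝓞 K)} (v : Fin 2 → K) (𝔞 : Submodule R K) : Prop :=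
  LinearIndependent ℤ v ∧ (Submodule.span ℤ (Set.range v) : Set K) = (𝔞 : Set K)

/-- `P` is an integer matrix of determinant `p` which sends the basis `v` of `𝔞` to a basis of
`𝔞 𝔭_R`. -/
def IsTransition {R : Subalgebra ℤ (𝓞 K)} (p : ℕ) (v : Fin 2 → K) (𝔞 : Submodule R K)
    (𝔭 : Ideal (𝓞 K)) (P : Matrix (Fin 2) (Fin 2) ℤ) : Prop :=
  P.det = p ∧ IsBasisOf (P.map (Int.cast : ℤ → K) *ᵥ v) (idealIn R 𝔭 • 𝔞)

end Orders

/-! ### Divisibility of algebraic numbers by divisors of a subfield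

`𝓞 ℂ` is the ring of all algebraic integers. -/

/-- `x ≈ I`: the complex number `x` is an algebraic integer, and the ideal it generates in the
ring of all algebraic integers is the one generated by the ideal `I` of `𝓞 K`. -/
def GeneratesSameDivisor {K : IntermediateField ℚ ℂ} (x : ℂ) (I : Ideal (𝓞 K)) : Prop :=
  ∃ y : 𝓞 ℂ, (y : ℂ) = x ∧ Ideal.span {y} = I.map (algebraMap (𝓞 K) (𝓞 ℂ))

/-- The complex number `x` is an algebraic integer divisible by `I`. -/
def DivisibleBy {K : IntermediateField ℚ ℂ} (x : ℂ) (I : Ideal (𝓞 K)) : Prop :=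
  ∃ y : 𝓞 ℂ, (y : ℂ) = x ∧ y ∈ I.map (algebraMap (𝓞 K) (𝓞 ℂ))

end CM

end

/-
The integer matrices of determinant `n` fall into finitely many classes under left multiplication by
`SL₂(ℤ)`, which `SL₂(ℤ)` permutes from the right. For a family of functions `g_S` indexed by the
classes and permuted accordingly, the coefficients of `∏ (X - g_S)` are invariant under `SL₂(ℤ)`; if
the `q`-expansions of the `g_S` are integral, these coefficients are polynomials in `j` with
integral coefficients, since successive multiples of powers of `j` remove the pole at the cusp. So
`g_S(α)` is integral as soon as `j(α)` is. The `q`-expansion of `φ_S`, for `S` upper triangular with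
diagonal `(a, d)`, is `a¹²` times an integral one whose leading coefficient is a unit, and `a`
divides `n`. Hence both `φ_S` and `n¹² / φ_S` are such families, and `φ_S(α)` divides `n¹²`.

Choose `l` in `R` with `(l) = 𝔭𝔢` and `𝔢` prime to `p`. Multiplication by `l` is given on `𝔞` by a
matrix `A` of determinant `pn`, where `p` does not divide `n`, so `A` fixes `α` and `pn` is not a
square. Therefore `∏ (j - j ∘ S)`, over the classes of determinant `pn`, is a polynomial in `j` with
leading coefficient a unit which vanishes at `α`, and `j(α)` is integral. As `𝔞 𝔭_R = l𝔞 + p𝔞`, the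
matrix `P` of a basis of `𝔞 𝔭_R` is a greatest common right divisor of `A` and `p`. Writing
`A = CP` one gets `φ_C(P(α)) φ_P(α) l¹² = (pn)¹²`, where `φ_C(P(α))` divides `n¹²` and `φ_P(α)`
divides `p¹²`; comparing the parts at `p` gives `φ_P(α) ≈ 𝔭bar¹²`.

For the second part, `f_S · (p¹² / φ_S) / p` is again such a family: `p` divides the expansions of
`f_S` for `S` in the class of `diag(p, 1)`, and those of `p¹² / φ_S` in all other classes. Hence `p`
divides `f_S(α) · p¹² / φ_S(α)`, and for `S = P_𝔭bar` the cofactor `p¹² / φ_S(α) ≈ 𝔭bar¹²` is prime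
to `𝔭`.
-/

noncomputable section

namespace CM

open UpperHalfPlane Filter Topology

local notation "𝕢" => Function.Periodic.qParam

section PowerSeries

lemma constantCoeff_map {A B : Type*} [CommRing A] [CommRing B] (f : A →+* B) (c : PowerSeries A) :
    PowerSeries.constantCoeff (c.map f) = f (PowerSeries.constantCoeff c) := by
  simp only [← PowerSeries.coeff_zero_eq_constantCoeff_apply, PowerSeries.coeff_map]

lemma exists_mul_eq_one {A : Type*} [CommRing A] {c : PowerSeries A}
    (hc : IsUnit (PowerSeries.constantCoeff c)) : ∃ d, c * d = 1 :=
  (PowerSeries.isUnit_iff_constantCoeff.mpr hc).exists_right_inv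

variable {A : Type*} [CommRing A] [Algebra A ℂ]

/-- The power series `c`, with coefficients mapped to `ℂ`, converges at `q` and has the sum `s`. -/
def HasEval (c : PowerSeries A) (q s : ℂ) : Prop :=
  HasSum (fun n : ℕ => algebraMap A ℂ (c.coeff n) * q ^ n) s

namespace HasEval

variable {c d : PowerSeries A} {q s t : ℂ}

lemma unique (hs : HasEval c q s) (ht : HasEval c q t) : s = t :=
  HasSum.unique hs ht

lemma add (hc : HasEval c q s) (hd : HasEval d q t) : HasEval (c + d) q (s + t) :=
  (HasSum.add hc hd).congr_fun fun n => by rw [map_add, map_add, add_mul]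

lemma neg (hc : HasEval c q s) : HasEval (-c) q (-s) :=
  (HasSum.neg hc).congr_fun fun n => by rw [map_neg, map_neg, neg_mul]

lemma summable_norm (hc : HasEval c q s) :
    Summable fun n : ℕ => ‖algebraMap A ℂ (c.coeff n) * q ^ n‖ :=
  hc.summable.norm

lemma mul (hc : HasEval c q s) (hd : HasEval d q t) : HasEval (c * d) q (s * t) := by
  have hsum := summable_norm_sum_mul_antidiagonal_of_summable_norm hc.summable_norm hd.summable_norm
  rw [← HasSum.tsum_eq hc, ← HasSum.tsum_eq hd,
    tsum_mul_tsum_eq_tsum_sum_antidiagonal_of_summable_norm hc.summable_norm hd.summable_norm]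
  refine hsum.of_norm.hasSum.congr_fun fun n => ?_
  rw [PowerSeries.coeff_mul, map_sum, Finset.sum_mul]
  refine Finset.sum_congr rfl fun x hx => ?_
  rw [← Finset.HasAntidiagonal.mem_antidiagonal.mp hx, pow_add, map_mul]
  ring

lemma monomial (k : ℕ) (a : A) (q : ℂ) :
    HasEval (PowerSeries.monomial k a) q (algebraMap A ℂ a * q ^ k) := by
  have h := hasSum_single
    (f := fun n : ℕ => algebraMap A ℂ ((PowerSeries.monomial k a).coeff n) * q ^ n) k
    (fun n hn => by rw [PowerSeries.coeff_monomial, if_neg hn, map_zero, zero_mul])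
  rwa [PowerSeries.coeff_monomial_same] at h

lemma C (a : A) (q : ℂ) : HasEval (PowerSeries.C a) q (algebraMap A ℂ a) := by
  simpa using monomial 0 a q

lemma one (q : ℂ) : HasEval (1 : PowerSeries A) q 1 := by
  simpa using C (1 : A) q

lemma X_pow (k : ℕ) (q : ℂ) : HasEval (PowerSeries.X ^ k : PowerSeries A) q (q ^ k) := by
  simpa [PowerSeries.X_pow_eq] using monomial k (1 : A) q

lemma rescale {u : A} (hc : HasEval c (algebraMap A ℂ u * q) s) :
    HasEval (PowerSeries.rescale u c) q s :=
  HasSum.congr_fun hc fun n => by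
    rw [PowerSeries.coeff_rescale, map_mul, map_pow, mul_pow]
    ring

lemma expand {m : ℕ} (hm : m ≠ 0) (hc : HasEval c (q ^ m) s) :
    HasEval (PowerSeries.expand m hm c) q s := by
  refine ((mul_right_injective₀ hm).hasSum_iff fun x hx => ?_).mp (HasSum.congr_fun hc fun n => ?_)
  · rw [PowerSeries.coeff_expand_of_not_dvd _ _ _ fun ⟨k, hk⟩ => hx ⟨k, hk.symm⟩, map_zero,
      zero_mul]
  · rw [Function.comp_apply, PowerSeries.coeff_expand_mul, pow_mul]

lemma map_iff {B : Type*} [CommRing B] [Algebra B ℂ] [Algebra A B] [IsScalarTower A B ℂ] :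
    HasEval (c.map (algebraMap A B)) q s ↔ HasEval c q s := by
  simp only [HasEval, PowerSeries.coeff_map, ← IsScalarTower.algebraMap_apply]

/-- The Taylor coefficients of `c`, packaged for the library of analytic functions. -/
def taylorSeries (c : PowerSeries A) : FormalMultilinearSeries ℂ ℂ ℂ :=
  .ofScalars ℂ fun n => algebraMap A ℂ (c.coeff n)

lemma hasFPowerSeriesAt_taylorSeries_iff {G : ℂ → ℂ} :
    HasFPowerSeriesAt G (taylorSeries c) 0 ↔ ∀ᶠ z in 𝓝 0, HasEval c z (G z) := by
  simp only [hasFPowerSeriesAt_iff, taylorSeries, FormalMultilinearSeries.coeff_ofScalars,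
    smul_eq_mul, mul_comm (_ ^ _), zero_add, HasEval]

lemma eq_zero_of_eventually {e : PowerSeries ℂ} (he : ∀ᶠ z in 𝓝 0, HasEval e z 0) : e = 0 := by
  ext n
  have h := (hasFPowerSeriesAt_taylorSeries_iff (G := 0).mpr he).eq_zero
  simpa [taylorSeries, FormalMultilinearSeries.coeff_ofScalars] using!
    congrArg (fun P => FormalMultilinearSeries.coeff P n) h

lemma exists_analyticAt (hc : HasEval c q s) (hq : q ≠ 0) :
    ∃ G : ℂ → ℂ, AnalyticAt ℂ G 0 ∧ ∀ᶠ z in 𝓝 0, HasEval c z (G z) := by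
  have hradius : 0 < (taylorSeries c).radius := by
    refine lt_of_lt_of_le (b := (‖q‖₊ : ENNReal)) (by simpa using hq)
      ((taylorSeries c).le_radius_of_summable (hc.summable_norm.congr fun n => ?_))
    rw [norm_mul, norm_pow, taylorSeries, FormalMultilinearSeries.ofScalars_norm, coe_nnnorm]
  have h := ((taylorSeries c).hasFPowerSeriesOnBall hradius).hasFPowerSeriesAt
  exact ⟨_, h.analyticAt, hasFPowerSeriesAt_taylorSeries_iff.mp h⟩

lemma at_zero (c : PowerSeries A) : HasEval c 0 (algebraMap A ℂ (PowerSeries.constantCoeff c)) := by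
  have h := hasSum_single (f := fun n : ℕ => algebraMap A ℂ (c.coeff n) * 0 ^ n) 0
    (fun n hn => by rw [zero_pow hn, mul_zero])
  rwa [pow_zero, mul_one, PowerSeries.coeff_zero_eq_constantCoeff_apply] at h

/-- The inverse of the analytic sum of `c` has a Taylor series over `ℂ`, which must be `d`. -/
lemma eventually_inv (hc : HasEval c q s) (hq : q ≠ 0) (hcd : c * d = 1) :
    ∀ᶠ z in 𝓝 (0 : ℂ), ∃ w, HasEval c z w ∧ HasEval d z w⁻¹ := by
  obtain ⟨G, hG, hcG⟩ := hc.exists_analyticAt hq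
  have hG0 : G 0 ≠ 0 := by
    rw [hcG.self_of_nhds.unique (at_zero c)]
    exact (((IsUnit.of_mul_eq_one d hcd).map PowerSeries.constantCoeff).map
      (algebraMap A ℂ)).ne_zero
  obtain ⟨P, hP⟩ := hG.inv hG0
  let e : PowerSeries ℂ := PowerSeries.mk P.coeff
  have he : ∀ᶠ z in 𝓝 0, HasEval e z (G z)⁻¹ := (hasFPowerSeriesAt_iff.mp hP).mono fun z hz => by
    simpa [e, HasEval, mul_comm] using hz
  have hce : c.map (algebraMap A ℂ) * e = 1 := by
    refine sub_eq_zero.mp (eq_zero_of_eventually ?_)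
    filter_upwards [hcG, he, hG.continuousAt.eventually_ne hG0] with z hcz hez hz
    simpa [sub_eq_add_neg, hz] using (((map_iff (B := ℂ)).mpr hcz).mul hez).add (one z).neg
  have hde : d.map (algebraMap A ℂ) = e := by
    refine left_inv_eq_right_inv (a := c.map (algebraMap A ℂ)) ?_ hce
    rw [← map_mul, mul_comm, hcd, map_one]
  filter_upwards [hcG, he] with z hcz hez
  exact ⟨G z, hcz, map_iff.mp (hde ▸ hez)⟩

end HasEval

end PowerSeries

section Expansions

variable {A : Type*} [CommRing A] [Algebra A ℂ]

/-- Near `i∞` the function `q ^ N * g` is the sum of the power series `c` in `q = exp (2πiz/h)`: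
the `q`-expansion of `g`, with coefficients in `A`, of pole order at most `N`. -/
def Expands (h : ℕ) (g : ℍ → ℂ) (N : ℤ) (c : PowerSeries A) : Prop :=
  ∀ᶠ z : ℍ in atImInfty, HasEval c (𝕢 h z) (𝕢 h z ^ N * g z)

lemma tendsto_qParam (h : ℕ) [NeZero h] : Tendsto (fun z : ℍ => 𝕢 h z) atImInfty (𝓝 0) :=
  qParam_tendsto_atImInfty (by exact_mod_cast NeZero.pos h)

namespace Expands

variable {h : ℕ} {f g : ℍ → ℂ} {M N : ℤ} {c d : PowerSeries A}

lemma add (hf : Expands h f N c) (hg : Expands h g N d) : Expands h (f + g) N (c + d) := by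
  filter_upwards [hf, hg] with z hfz hgz
  simpa only [Pi.add_apply, mul_add] using hfz.add hgz

lemma neg (hf : Expands h f N c) : Expands h (-f) N (-c) := by
  filter_upwards [hf] with z hfz
  simpa only [Pi.neg_apply, mul_neg] using hfz.neg

lemma sub (hf : Expands h f N c) (hg : Expands h g N d) : Expands h (f - g) N (c - d) := by
  simpa only [sub_eq_add_neg] using hf.add hg.neg

lemma mul (hf : Expands h f M c) (hg : Expands h g N d) :
    Expands h (f * g) (M + N) (c * d) := by
  filter_upwards [hf, hg] with z hfz hgz
  rw [zpow_add₀ (Function.Periodic.qParam_ne_zero _), Pi.mul_apply, mul_mul_mul_comm]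
  exact hfz.mul hgz

lemma const (h : ℕ) (a : A) : Expands h (fun _ => algebraMap A ℂ a) 0 (PowerSeries.C a) :=
  .of_forall fun z => by simpa using HasEval.C a (𝕢 h z)

lemma one (h : ℕ) : Expands h 1 0 (1 : PowerSeries A) :=
  .of_forall fun z => by simpa using HasEval.one (A := A) (𝕢 h z)

lemma prod {ι : Type*} (s : Finset ι) {f : ι → ℍ → ℂ} {N : ι → ℤ} {c : ι → PowerSeries A}
    (hf : ∀ i ∈ s, Expands h (f i) (N i) (c i)) :
    Expands h (∏ i ∈ s, f i) (∑ i ∈ s, N i) (∏ i ∈ s, c i) := by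
  classical
  induction s using Finset.induction_on with
  | empty => simpa using one h
  | insert i s hi ih =>
    rw [Finset.prod_insert hi, Finset.sum_insert hi, Finset.prod_insert hi]
    exact (hf i (Finset.mem_insert_self i s)).mul
      (ih fun k hk => hf k (Finset.mem_insert_of_mem hk))

lemma pow (hf : Expands h f N c) (k : ℕ) : Expands h (f ^ k) (k * N) (c ^ k) := by
  simpa using prod (Finset.range k) (fun i _ => hf)

lemma shift (hf : Expands h f N c) (k : ℕ) : Expands h f (N + k) (PowerSeries.X ^ k * c) := by
  filter_upwards [hf] with z hfz
  rw [zpow_add₀ (Function.Periodic.qParam_ne_zero _), zpow_natCast, mul_comm (_ ^ N), mul_assoc]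
  exact (HasEval.X_pow k _).mul hfz

lemma exists_of_le (hf : Expands h f M c) (hMN : M ≤ N) :
    ∃ d : PowerSeries A, Expands h f N d := by
  obtain ⟨k, rfl⟩ := Int.le.dest hMN
  exact ⟨_, hf.shift k⟩

lemma unshift (hf : Expands h f N (PowerSeries.X * c)) : Expands h f (N - 1) c := by
  filter_upwards [hf] with z hfz
  have hq : 𝕢 h z ≠ 0 := Function.Periodic.qParam_ne_zero _
  have htail := ((hasSum_nat_add_iff' 1).mpr hfz).mul_right (𝕢 h z)⁻¹
  rw [Finset.sum_range_one, PowerSeries.coeff_zero_X_mul, map_zero, zero_mul, sub_zero,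
    mul_right_comm, ← zpow_sub_one₀ hq] at htail
  refine htail.congr_fun fun n => ?_
  rw [PowerSeries.coeff_succ_X_mul, pow_succ, mul_assoc, mul_inv_cancel_right₀ hq]

lemma map {B : Type*} [CommRing B] [Algebra B ℂ] [Algebra A B] [IsScalarTower A B ℂ]
    (hf : Expands h f N c) : Expands h f N (c.map (algebraMap A B)) :=
  hf.mono fun _ => HasEval.map_iff.mpr

lemma of_const_mul {a : A} (ha : algebraMap A ℂ a ≠ 0)
    (hf : Expands h (fun z => algebraMap A ℂ a * f z) N (PowerSeries.C a * c)) :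
    Expands h f N c := by
  filter_upwards [hf] with z hfz
  have hdiv := HasSum.mul_left (algebraMap A ℂ a)⁻¹ hfz
  rw [mul_left_comm, inv_mul_cancel_left₀ ha] at hdiv
  refine hdiv.congr_fun fun n => ?_
  rw [PowerSeries.coeff_C_mul, map_mul, mul_assoc, inv_mul_cancel_left₀ ha]

lemma inv [NeZero h] (hf : Expands h f N c) (hcd : c * d = 1) : Expands h f⁻¹ (-N) d := by
  obtain ⟨z₀, hz₀⟩ := hf.exists
  have hinv := hz₀.eventually_inv (Function.Periodic.qParam_ne_zero _) hcd
  filter_upwards [hf, (tendsto_qParam h).eventually hinv] with z hfz ⟨w, hcw, hdw⟩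
  rwa [← hfz.unique hcw, mul_inv, ← zpow_neg] at hdw

lemma tendsto [NeZero h] (hf : Expands h f N c) :
    Tendsto (fun z : ℍ => 𝕢 h z ^ N * f z) atImInfty
      (𝓝 (algebraMap A ℂ (PowerSeries.constantCoeff c))) := by
  obtain ⟨z₀, hz₀⟩ := hf.exists
  obtain ⟨G, hG, hcG⟩ := hz₀.exists_analyticAt (Function.Periodic.qParam_ne_zero _)
  rw [← hcG.self_of_nhds.unique (HasEval.at_zero c)]
  refine (hG.continuousAt.tendsto.comp (tendsto_qParam h)).congr' ?_
  filter_upwards [hf, (tendsto_qParam h).eventually hcG] with z hfz hGz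
  exact hGz.unique hfz

lemma comp {n m : ℕ} (hm : m ≠ 0) (hf : Expands 1 f N c) {w : ℍ → ℍ}
    (hw : Tendsto w atImInfty atImInfty) (ζ : Aˣ)
    (hq : ∀ z, 𝕢 1 (w z) = algebraMap A ℂ ζ * 𝕢 n z ^ m) :
    Expands n (f ∘ w) (m * N) (PowerSeries.C ((ζ ^ (-N) : Aˣ) : A) *
      PowerSeries.expand m hm (PowerSeries.rescale (ζ : A) c)) := by
  filter_upwards [hw.eventually hf] with z hz
  rw [Nat.cast_one, hq] at hz
  have hζ : algebraMap A ℂ ((ζ ^ (-N) : Aˣ) : A) * algebraMap A ℂ ζ ^ N = 1 := by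
    have hval := (Units.val_zpow_eq_zpow_val (Units.map (algebraMap A ℂ : A →* ℂ) ζ) N).symm
    rw [← map_zpow, Units.coe_map, Units.coe_map] at hval
    rw [zpow_neg, ← MonoidHom.coe_coe, hval, ← map_mul, Units.inv_mul, map_one]
  convert (HasEval.C ((ζ ^ (-N) : Aˣ) : A) (𝕢 n z)).mul (hz.rescale.expand hm) using 1
  rw [mul_zpow, ← mul_assoc, ← mul_assoc, hζ, one_mul, zpow_mul, zpow_natCast, Function.comp_apply]

end Expands

end Expansions

section LevelOneExpansions

/-- The generating series `∑ σ_k(n) qⁿ` of the divisor sums. -/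
def sigmaSeries (k : ℕ) : PowerSeries ℤ :=
  PowerSeries.mk fun n => (ArithmeticFunction.sigma k n : ℤ)

lemma coeff_sigmaSeries (k n : ℕ) :
    (sigmaSeries k).coeff n = (ArithmeticFunction.sigma k n : ℤ) :=
  PowerSeries.coeff_mk _ _

lemma constantCoeff_sigmaSeries (k : ℕ) : PowerSeries.constantCoeff (sigmaSeries k) = 0 := by
  simp [sigmaSeries]

lemma expands_E₄ : Expands 1 ModularForm.E₄ 0 (1 + PowerSeries.C 240 * sigmaSeries 3) := by
  refine .of_forall fun z => ?_
  rw [zpow_zero, one_mul, Nat.cast_one]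
  refine (ModularForm.hasSum_qExpansion ModularForm.E₄ one_pos one_mem_strictPeriods_SL z).congr_fun
    fun n => ?_
  rw [EisensteinSeries.E_qExpansion_coeff _ ⟨2, rfl⟩, show bernoulli 4 = -1 / 30 by decide +kernel,
    map_add, PowerSeries.coeff_C_mul, coeff_sigmaSeries, PowerSeries.coeff_one]
  rcases eq_or_ne n 0 with rfl | hn
  · simp
  · rw [if_neg hn, if_neg hn]
    congr 1
    norm_num

lemma expands_E₆ : Expands 1 ModularForm.E₆ 0 (1 - PowerSeries.C 504 * sigmaSeries 5) := by
  refine .of_forall fun z => ?_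
  rw [zpow_zero, one_mul, Nat.cast_one]
  refine (ModularForm.hasSum_qExpansion ModularForm.E₆ one_pos one_mem_strictPeriods_SL z).congr_fun
    fun n => ?_
  rw [EisensteinSeries.E_qExpansion_coeff _ ⟨3, rfl⟩, show bernoulli 6 = 1 / 42 by decide +kernel,
    map_sub, PowerSeries.coeff_C_mul, coeff_sigmaSeries, PowerSeries.coeff_one]
  rcases eq_or_ne n 0 with rfl | hn
  · simp
  · rw [if_neg hn, if_neg hn]
    congr 1
    norm_num

lemma twelve_dvd_sigma (n : ℕ) :
    12 ∣ 5 * ArithmeticFunction.sigma 3 n + 7 * ArithmeticFunction.sigma 5 n := by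
  rw [ArithmeticFunction.sigma_apply, ArithmeticFunction.sigma_apply, Finset.mul_sum,
    Finset.mul_sum, ← Finset.sum_add_distrib]
  refine Finset.dvd_sum fun d _ => ?_
  have hmod : ∀ x : ZMod 12, 5 * x ^ 3 + 7 * x ^ 5 = 0 := by decide
  rw [← ZMod.natCast_eq_zero_iff]
  exact_mod_cast hmod d

lemma exists_C_twelve_mul_eq : ∃ G : PowerSeries ℤ, PowerSeries.coeff 1 G = 1 ∧
    PowerSeries.C 12 * G = PowerSeries.C 5 * sigmaSeries 3 + PowerSeries.C 7 * sigmaSeries 5 := by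
  choose g hg using twelve_dvd_sigma
  refine ⟨PowerSeries.mk fun n => (g n : ℤ), ?_, PowerSeries.ext fun n => ?_⟩
  · have h := hg 1
    rw [ArithmeticFunction.sigma_one, ArithmeticFunction.sigma_one] at h
    rw [PowerSeries.coeff_mk]
    lia
  · rw [PowerSeries.coeff_C_mul, PowerSeries.coeff_mk, map_add, PowerSeries.coeff_C_mul,
      PowerSeries.coeff_C_mul, coeff_sigmaSeries, coeff_sigmaSeries]
    exact_mod_cast (hg n).symm

lemma exists_E₄_cube_sub_E₆_sq_eq : ∃ D : PowerSeries ℤ, PowerSeries.constantCoeff D = 1 ∧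
    (1 + PowerSeries.C 240 * sigmaSeries 3) ^ 3 - (1 - PowerSeries.C 504 * sigmaSeries 5) ^ 2 =
      PowerSeries.C 1728 * (PowerSeries.X * D) := by
  obtain ⟨G, hG1, hG⟩ := exists_C_twelve_mul_eq
  obtain ⟨A, hA⟩ := PowerSeries.X_dvd_iff.mpr (constantCoeff_sigmaSeries 3)
  obtain ⟨B, hB⟩ := PowerSeries.X_dvd_iff.mpr (constantCoeff_sigmaSeries 5)
  obtain ⟨F, rfl⟩ : PowerSeries.X ∣ G := by
    have h0 := congrArg PowerSeries.constantCoeff hG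
    simp only [map_add, map_mul, constantCoeff_sigmaSeries, mul_zero, add_zero,
      PowerSeries.constantCoeff_C] at h0
    exact PowerSeries.X_dvd_iff.mpr ((mul_eq_zero.mp h0).resolve_left (by norm_num))
  rw [← zero_add 1, PowerSeries.coeff_succ_X_mul,
    PowerSeries.coeff_zero_eq_constantCoeff_apply] at hG1
  refine ⟨F + PowerSeries.X * (PowerSeries.C 100 * A ^ 2 +
    PowerSeries.C 8000 * (PowerSeries.X * A ^ 3) - PowerSeries.C 147 * B ^ 2), ?_, ?_⟩
  · rw [map_add, hG1, map_mul, PowerSeries.constantCoeff_X, zero_mul, add_zero]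
  · rw [hA, hB] at hG ⊢
    simp only [map_ofNat] at hG ⊢
    linear_combination -144 * hG

variable (A : Type*) [CommRing A] [Algebra A ℂ]

lemma exists_expands_discriminant : ∃ c : PowerSeries A,
    Expands 1 ModularForm.discriminant (-1) c ∧ PowerSeries.constantCoeff c = 1 := by
  obtain ⟨D, hD0, hD⟩ := exists_E₄_cube_sub_E₆_sq_eq
  have hΔ : Expands 1 ModularForm.discriminant 0 (PowerSeries.X * D) := by
    refine .of_const_mul (a := 1728) (by norm_num) ?_
    have h := (expands_E₄.pow 3).sub (expands_E₆.pow 2)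
    rw [hD, mul_zero] at h
    convert! h using 1
    ext z
    rw [ModularForm.discriminant_eq_E₄_cube_sub_E₆_sq, map_ofNat, Pi.sub_apply, Pi.pow_apply,
      Pi.pow_apply]
    ring
  exact ⟨_, hΔ.unshift.map, by rw [constantCoeff_map, hD0, map_one]⟩

lemma exists_expands_j : ∃ c : PowerSeries A,
    Expands 1 j 1 c ∧ PowerSeries.constantCoeff c = 1 := by
  obtain ⟨c, hc, hc0⟩ := exists_expands_discriminant A
  obtain ⟨d, hcd⟩ := exists_mul_eq_one (hc0 ▸ isUnit_one)
  have hd0 := congrArg PowerSeries.constantCoeff hcd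
  rw [map_mul, hc0, one_mul, map_one] at hd0
  have hj := (expands_E₄.map.pow 3).mul (hc.inv hcd)
  rw [mul_zero, zero_add, neg_neg] at hj
  refine ⟨_, hj, ?_⟩
  rw [map_mul, hd0, mul_one, map_pow, constantCoeff_map, map_add, map_mul,
    constantCoeff_sigmaSeries, mul_zero, add_zero, map_one, map_one, one_pow]

end LevelOneExpansions

section LevelOne

lemma discriminant_smul (γ : SL(2, ℤ)) (z : ℍ) : ModularForm.discriminant (γ • z) =
    ((γ 1 0 : ℂ) * z + γ 1 1) ^ 12 * ModularForm.discriminant z := by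
  have h := SlashInvariantForm.slash_action_eqn'' CuspForm.discriminant
    (γ := Matrix.SpecialLinearGroup.mapGL ℝ γ) (MonoidHom.mem_range.mpr ⟨γ, rfl⟩) z
  simpa [denom] using! h

lemma E₄_smul (γ : SL(2, ℤ)) (z : ℍ) : ModularForm.E₄ (γ • z) =
    ((γ 1 0 : ℂ) * z + γ 1 1) ^ 4 * ModularForm.E₄ z := by
  have h := SlashInvariantForm.slash_action_eqn'' ModularForm.E₄
    (γ := Matrix.SpecialLinearGroup.mapGL ℝ γ) (MonoidHom.mem_range.mpr ⟨γ, rfl⟩) z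
  simpa [denom] using! h

lemma j_smul (γ : SL(2, ℤ)) (z : ℍ) : j (γ • z) = j z := by
  have hγz := ModularForm.discriminant_ne_zero (γ • z)
  rw [discriminant_smul] at hγz
  rw [j, j, E₄_smul, discriminant_smul, mul_pow, ← pow_mul,
    mul_div_mul_left _ _ (left_ne_zero_of_mul hγz)]

lemma mdifferentiable_discriminant :
    MDifferentiable 𝓘(ℂ) 𝓘(ℂ) ModularForm.discriminant :=
  CuspForm.discriminant.holo'

lemma mdifferentiable_j : MDifferentiable 𝓘(ℂ) 𝓘(ℂ) j :=
  (ModularForm.E₄.holo'.pow 3).div mdifferentiable_discriminant ModularForm.discriminant_ne_zero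

/-- The algebra of holomorphic functions on the upper half-plane which are invariant under
`SL₂(ℤ)`, without any condition at the cusp. -/
def levelOne : Subalgebra ℂ (ℍ → ℂ) where
  carrier := {F | MDifferentiable 𝓘(ℂ) 𝓘(ℂ) F ∧ ∀ (γ : SL(2, ℤ)) z, F (γ • z) = F z}
  mul_mem' := fun ⟨hF, hFγ⟩ ⟨hG, hGγ⟩ =>
    ⟨hF.mul hG, fun γ z => congrArg₂ (· * ·) (hFγ γ z) (hGγ γ z)⟩
  add_mem' := fun ⟨hF, hFγ⟩ ⟨hG, hGγ⟩ =>
    ⟨hF.add hG, fun γ z => congrArg₂ (· + ·) (hFγ γ z) (hGγ γ z)⟩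
  algebraMap_mem' _ := ⟨mdifferentiable_const, fun _ _ => rfl⟩

lemma j_mem_levelOne : j ∈ levelOne := ⟨mdifferentiable_j, j_smul⟩

variable {F : ℍ → ℂ}

lemma slash_zero_eq_of_mem_levelOne (hF : F ∈ levelOne) (γ : SL(2, ℤ)) :
    SlashAction.map (0 : ℤ) γ F = F := by
  ext z
  rw [ModularForm.SL_slash_apply, hF.2, neg_zero, zpow_zero, mul_one]

lemma eq_of_mem_levelOne_of_tendsto (hF : F ∈ levelOne) {l : ℂ}
    (hl : Tendsto F atImInfty (𝓝 l)) (z : ℍ) : F z = l := by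
  let f : ModularForm (Matrix.SpecialLinearGroup.mapGL ℝ (R := ℤ) (n := Fin 2)).range 0 :=
    { toFun := F
      slash_action_eq' := fun _ ⟨γ, hγ⟩ => hγ ▸ slash_zero_eq_of_mem_levelOne hF γ
      holo' := hF.1
      bdd_at_cusps' := fun {c} hc => by
        rw [Subgroup.IsArithmetic.isCusp_iff_isCusp_SL2Z] at hc
        rw [OnePoint.isBoundedAt_iff_forall_SL2Z hc]
        intro γ _
        rw [slash_zero_eq_of_mem_levelOne hF γ]
        exact hl.isBigO_one ℝ }
  obtain ⟨c, hc : F = Function.const ℍ c⟩ := ModularFormClass.levelOne_weight_zero_const f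
  rw [hc] at hl ⊢
  exact tendsto_nhds_unique tendsto_const_nhds hl

lemma tendsto_T_smul : Tendsto (fun z : ℍ => ModularGroup.T • z) atImInfty atImInfty := by
  rw [atImInfty, tendsto_comap_iff]
  refine tendsto_comap.congr fun z => ?_
  rw [Function.comp_apply, modular_T_smul, vadd_im]

lemma qParam_T_smul (h : ℕ) (z : ℍ) : 𝕢 h (ModularGroup.T • z : ℍ) =
    Complex.exp (2 * Real.pi * Complex.I / h) * 𝕢 h z := by
  rw [modular_T_smul, coe_vadd, Function.Periodic.qParam, Function.Periodic.qParam,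
    ← Complex.exp_add]
  congr 1
  push_cast
  ring

lemma qParam_one (h : ℕ) [NeZero h] (z : ℍ) : 𝕢 1 z = 𝕢 h z ^ h := by
  have hh : (h : ℂ) ≠ 0 := NeZero.ne _
  rw [Function.Periodic.qParam, Function.Periodic.qParam, ← Complex.exp_nat_mul]
  congr 1
  push_cast
  field_simp

variable {A : Type*} [CommRing A] [Algebra A ℂ] {h : ℕ} [NeZero h] {c : PowerSeries A}

namespace Expands

lemma eq_zero_of_neg (hF : F ∈ levelOne) {N : ℤ} (hN : N < 0) (hc : Expands h F N c) (z : ℍ) :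
    F z = 0 := by
  refine eq_of_mem_levelOne_of_tendsto hF ?_ z
  have hlim := ((tendsto_qParam h).pow (-N).toNat).mul hc.tendsto
  rw [zero_pow (by omega), zero_mul] at hlim
  refine hlim.congr fun z => ?_
  rw [← mul_assoc, ← zpow_natCast, ← zpow_add₀ (Function.Periodic.qParam_ne_zero _),
    Int.toNat_of_nonneg (by omega), neg_add_cancel, zpow_zero, one_mul]

/-- The translation `z ↦ z + 1` multiplies the leading term by a root of unity. -/
lemma dvd_of_ne_zero (hF : F ∈ levelOne) {N : ℤ} (hc : Expands h F N c)
    (hc0 : algebraMap A ℂ (PowerSeries.constantCoeff c) ≠ 0) : (h : ℤ) ∣ N := by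
  rw [← (Complex.isPrimitiveRoot_exp h (NeZero.ne h)).zpow_eq_one_iff_dvd]
  refine (mul_eq_right₀ hc0).mp (tendsto_nhds_unique (hc.tendsto.const_mul _) ?_)
  refine (hc.tendsto.comp tendsto_T_smul).congr fun z => ?_
  rw [Function.comp_apply, qParam_T_smul, hF.2, mul_zpow, mul_assoc]

lemma ramify {N : ℤ} (hc : Expands 1 F N c) (h : ℕ) [NeZero h] : ∃ d : PowerSeries A,
    Expands h F (h * N) d ∧ PowerSeries.constantCoeff d = PowerSeries.constantCoeff c := by
  refine ⟨_, hc.comp (NeZero.ne h) tendsto_id 1 fun z => ?_, by simp⟩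
  rw [id, Units.val_one, map_one, one_mul, qParam_one h]

lemma exists_sub_mul_j_pow {m : ℕ} (hc : Expands h F (h * m) c) : ∃ d : PowerSeries A,
    Expands h (F - (fun _ => algebraMap A ℂ (PowerSeries.constantCoeff c)) * j ^ m)
      (h * m - 1) d := by
  obtain ⟨e, he, he0⟩ := exists_expands_j A
  obtain ⟨e', he', he'0⟩ := he.ramify h
  rw [he0] at he'0
  have hdiff := (Expands.const h (PowerSeries.constantCoeff c)).mul (he'.pow m)
  rw [mul_one, zero_add, mul_comm (m : ℤ)] at hdiff
  obtain ⟨d, hd⟩ : PowerSeries.X ∣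
      c - PowerSeries.C (PowerSeries.constantCoeff c) * e' ^ m := by
    rw [PowerSeries.X_dvd_iff, map_sub, map_mul, map_pow, he'0, one_pow, mul_one,
      PowerSeries.constantCoeff_C, sub_self]
  exact ⟨d, (hd ▸ hc.sub hdiff).unshift⟩

theorem exists_polynomial [FaithfulSMul A ℂ] {N : ℕ} (hF : F ∈ levelOne)
    (hc : Expands h F (N - 1) c) : ∃ Q : Polynomial A, (∀ z, F z = Polynomial.aeval (j z) Q) ∧
      ∀ m, N ≤ h * m → Q.degree < m := by
  induction N generalizing F c with
  | zero =>
    exact ⟨0, fun z => by rw [map_zero, hc.eq_zero_of_neg hF (by norm_num)],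
      fun m _ => by rw [Polynomial.degree_zero]; exact WithBot.bot_lt_coe m⟩
  | succ N ih =>
    rw [Nat.cast_succ, add_sub_cancel_right] at hc
    by_cases hc0 : PowerSeries.constantCoeff c = 0
    · obtain ⟨d, rfl⟩ := PowerSeries.X_dvd_iff.mpr hc0
      obtain ⟨Q, hQ, hdeg⟩ := ih hF hc.unshift
      exact ⟨Q, hQ, fun m hm => hdeg m (by omega)⟩
    · obtain ⟨m, rfl⟩ : h ∣ N := by
        exact_mod_cast hc.dvd_of_ne_zero hF (by
          rwa [Ne, FaithfulSMul.algebraMap_eq_zero_iff])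
      rw [Nat.cast_mul] at hc ih
      obtain ⟨d, hd⟩ := hc.exists_sub_mul_j_pow
      obtain ⟨Q, hQ, hdeg⟩ := ih (sub_mem hF (mul_mem (levelOne.algebraMap_mem _)
        (pow_mem j_mem_levelOne m))) hd
      refine ⟨Polynomial.C (PowerSeries.constantCoeff c) * Polynomial.X ^ m + Q,
        fun z => ?_, fun k hk => ?_⟩
      · rw [map_add, ← hQ z]
        simp
      · have hmk : m < k := lt_of_mul_lt_mul_left' (a := h) (by omega)
        exact (Polynomial.degree_add_le _ _).trans_lt (max_lt
          ((Polynomial.degree_C_mul_X_pow_le _ _).trans_lt (by exact_mod_cast hmk))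
          ((hdeg m le_rfl).trans (by exact_mod_cast hmk)))

lemma exists_monic_polynomial [FaithfulSMul A ℂ] {N : ℕ} (hF : F ∈ levelOne)
    (hc : Expands h F N c) (hc1 : PowerSeries.constantCoeff c = 1) :
    ∃ Q : Polynomial A, Q.Monic ∧ ∀ z, F z = Polynomial.aeval (j z) Q := by
  obtain ⟨m, rfl⟩ : h ∣ N := by
    exact_mod_cast hc.dvd_of_ne_zero hF (by rw [hc1, map_one]; exact one_ne_zero)
  rw [Nat.cast_mul] at hc
  obtain ⟨d, hd⟩ := hc.exists_sub_mul_j_pow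
  obtain ⟨Q, hQ, hdeg⟩ := exists_polynomial (N := h * m) (sub_mem hF (mul_mem
    (levelOne.algebraMap_mem _) (pow_mem j_mem_levelOne m))) (by rwa [Nat.cast_mul])
  refine ⟨Polynomial.X ^ m + Q, Polynomial.monic_X_pow_add (hdeg m le_rfl), fun z => ?_⟩
  rw [map_add, ← hQ z]
  simp [hc1]

end Expands

end LevelOne

section IntegralRing

/-- The ring of holomorphic functions on the upper half-plane with a `q`-expansion in powers of
`exp (2πiz/h)` whose coefficients are algebraic integers. -/
def integralRing (h : ℕ) : Subring (ℍ → ℂ) where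
  carrier := {F | MDifferentiable 𝓘(ℂ) 𝓘(ℂ) F ∧ ∃ N, ∃ c : PowerSeries (𝓞 ℂ), Expands h F N c}
  mul_mem' := fun ⟨hf, M, c, hc⟩ ⟨hg, N, d, hd⟩ => ⟨hf.mul hg, _, _, hc.mul hd⟩
  one_mem' := ⟨mdifferentiable_const, 0, _, .one h⟩
  add_mem' := fun ⟨hf, M, c, hc⟩ ⟨hg, N, d, hd⟩ => by
    obtain ⟨c', hc'⟩ := hc.exists_of_le (le_max_left M N)
    obtain ⟨d', hd'⟩ := hd.exists_of_le (le_max_right M N)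
    exact ⟨hf.add hg, _, _, hc'.add hd'⟩
  zero_mem' := ⟨mdifferentiable_const, 0, 0, by simpa [Pi.zero_def] using Expands.const h (0 : 𝓞 ℂ)⟩
  neg_mem' := fun ⟨hf, M, c, hc⟩ => ⟨hf.neg, _, _, hc.neg⟩

lemma const_mem_integralRing (h : ℕ) {a : ℂ} (ha : IsIntegral ℤ a) :
    (fun _ => a) ∈ integralRing h :=
  ⟨mdifferentiable_const, 0, _, .const h (⟨a, ha⟩ : 𝓞 ℂ)⟩

lemma j_mem_integralRing (h : ℕ) [NeZero h] : j ∈ integralRing h := by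
  obtain ⟨c, hc, -⟩ := exists_expands_j (𝓞 ℂ)
  obtain ⟨d, hd, -⟩ := hc.ramify h
  exact ⟨mdifferentiable_j, _, d, hd⟩

lemma isIntegral_apply_of_isIntegral_j {h : ℕ} [NeZero h] {F : ℍ → ℂ} (hF : F ∈ integralRing h)
    (hF' : F ∈ levelOne) {z : ℍ} (hz : IsIntegral ℤ (j z)) : IsIntegral ℤ (F z) := by
  obtain ⟨-, N, c, hc⟩ := hF
  obtain ⟨d, hd⟩ := hc.exists_of_le (show N ≤ ((N + 1).toNat : ℤ) - 1 by omega)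
  obtain ⟨Q, hQ, -⟩ := hd.exists_polynomial hF'
  obtain ⟨y, hy⟩ := (IsIntegralClosure.isIntegral_iff (A := 𝓞 ℂ)).mp hz
  rw [hQ z, ← hy, Polynomial.aeval_algebraMap_apply]
  exact NumberField.RingOfIntegers.isIntegral_coe _

end IntegralRing

section IntegerMatrices

/-- The factor of automorphy `cz + d` of an integer matrix with lower row `(c, d)`. -/
def automorphyFactor (S : Matrix (Fin 2) (Fin 2) ℤ) (z : ℍ) : ℂ := (S 1 0 : ℂ) * z + S 1 1

variable {S T : Matrix (Fin 2) (Fin 2) ℤ}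

lemma automorphyFactor_ne_zero (hS : 0 < S.det) (z : ℍ) : automorphyFactor S z ≠ 0 := by
  intro h
  have h10 : S 1 0 = 0 := by
    simpa [automorphyFactor, z.im_ne_zero] using congrArg Complex.im h
  have h11 : S 1 1 = 0 := by
    simpa [automorphyFactor, h10] using h
  rw [Matrix.det_fin_two, h10, h11, mul_zero, mul_zero, sub_zero] at hS
  exact hS.false

lemma moebius_mul_automorphyFactor (hS : 0 < S.det) (z : ℍ) :
    (moebius S z : ℂ) * automorphyFactor S z = (S 0 0 : ℂ) * z + S 0 1 := by
  rw [coe_moebius S hS]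
  exact div_mul_cancel₀ _ (automorphyFactor_ne_zero hS z)

lemma automorphyFactor_mul (S : Matrix (Fin 2) (Fin 2) ℤ) (hT : 0 < T.det) (z : ℍ) :
    automorphyFactor (S * T) z = automorphyFactor S (moebius T z) * automorphyFactor T z := by
  have h := moebius_mul_automorphyFactor hT z
  simp only [automorphyFactor, Matrix.mul_apply, Fin.sum_univ_two] at h ⊢
  push_cast
  linear_combination (-(S 1 0 : ℂ)) * h

lemma det_mul_pos (hS : 0 < S.det) (hT : 0 < T.det) : 0 < (S * T).det :=
  (Matrix.det_mul S T).symm ▸ mul_pos hS hT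

lemma moebius_mul (hS : 0 < S.det) (hT : 0 < T.det) (z : ℍ) :
    moebius (S * T) z = moebius S (moebius T z) := by
  have hST := det_mul_pos hS hT
  have hnum := moebius_mul_automorphyFactor hT z
  have hden : automorphyFactor T z = (T 1 0 : ℂ) * z + T 1 1 := rfl
  ext
  refine mul_right_cancel₀ (automorphyFactor_ne_zero hST z) ?_
  rw [moebius_mul_automorphyFactor hST, automorphyFactor_mul S hT, ← mul_assoc,
    moebius_mul_automorphyFactor hS]
  simp only [Matrix.mul_apply, Fin.sum_univ_two]
  push_cast
  linear_combination (-(S 0 0 : ℂ)) * hnum - (S 0 1 : ℂ) * hden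

lemma det_specialLinearGroup_pos (γ : SL(2, ℤ)) : 0 < (γ : Matrix (Fin 2) (Fin 2) ℤ).det :=
  γ.2.symm ▸ one_pos

lemma moebius_specialLinearGroup (γ : SL(2, ℤ)) (z : ℍ) :
    moebius (γ : Matrix (Fin 2) (Fin 2) ℤ) z = γ • z := by
  ext
  rw [coe_moebius _ (det_specialLinearGroup_pos γ), coe_specialLinearGroup_apply]
  simp

lemma mdifferentiable_moebius (hS : 0 < S.det) : MDifferentiable 𝓘(ℂ) 𝓘(ℂ) (moebius S) := by
  have hdet : 0 < (S.map (Int.cast : ℤ → ℝ)).det := by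
    rw [← Int.cast_det]
    exact Int.cast_pos.mpr hS
  let g := Matrix.GeneralLinearGroup.mkOfDetNeZero (S.map (Int.cast : ℤ → ℝ)) hdet.ne'
  suffices hg : moebius S = fun z : ℍ => g • z from hg ▸ mdifferentiable_smul (g := g) hdet
  ext z
  rw [coe_moebius S hS, coe_smul_of_det_pos (g := g) hdet]
  simp [num, denom, g, Matrix.GeneralLinearGroup.mkOfDetNeZero]

lemma mdifferentiable_automorphyFactor (S : Matrix (Fin 2) (Fin 2) ℤ) :
    MDifferentiable 𝓘(ℂ) 𝓘(ℂ) (automorphyFactor S) :=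
  (mdifferentiable_const.mul mdifferentiable_coe).add mdifferentiable_const

variable {n : ℕ}

lemma det_pos_of_fixedDet [NeZero n] (A : FixedDetMatrix (Fin 2) ℤ n) : 0 < A.1.det := by
  rw [A.2]
  exact_mod_cast NeZero.pos n

lemma exists_smul_mem_reps [NeZero n] (A : FixedDetMatrix (Fin 2) ℤ n) :
    ∃ γ : SL(2, ℤ), γ • A ∈ FixedDetMatrices.reps (n : ℤ) := by
  have hn : (n : ℤ) ≠ 0 := by exact_mod_cast NeZero.ne n
  induction A using FixedDetMatrices.induction_on hn with
  | h0 A h1 h2 h3 h4 => exact ⟨1, by rw [one_smul]; exact ⟨h1, h2, h3, h4⟩⟩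
  | hS B hB =>
    obtain ⟨γ, hγ⟩ := hB
    exact ⟨γ * ModularGroup.S⁻¹, by rwa [smul_smul, inv_mul_cancel_right]⟩
  | hT B hB =>
    obtain ⟨γ, hγ⟩ := hB
    exact ⟨γ * ModularGroup.T⁻¹, by rwa [smul_smul, inv_mul_cancel_right]⟩

lemma exists_smul_eq_upper_triangular [NeZero n] (A : FixedDetMatrix (Fin 2) ℤ n) :
    ∃ (γ : SL(2, ℤ)) (a d : ℕ) (b : ℤ), a ≠ 0 ∧ d ≠ 0 ∧ a * d = n ∧
      (γ • A).1 = !![(a : ℤ), b; 0, (d : ℤ)] := by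
  obtain ⟨γ, h10, h00, -, -⟩ := exists_smul_mem_reps A
  have hdet := (γ • A).2
  rw [Matrix.det_fin_two, h10, mul_zero, sub_zero] at hdet
  have h11 : 0 < (γ • A).1 1 1 :=
    pos_of_mul_pos_right (hdet.symm ▸ Int.natCast_pos.mpr (NeZero.pos n)) h00.le
  obtain ⟨a, ha⟩ := Int.eq_ofNat_of_zero_le h00.le
  obtain ⟨d, hd⟩ := Int.eq_ofNat_of_zero_le h11.le
  refine ⟨γ, a, d, (γ • A).1 0 1, by omega, by omega, ?_, ?_⟩
  · rw [ha, hd] at hdet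
    exact_mod_cast hdet
  · rw [Matrix.eta_fin_two (γ • A).1, ha, hd, h10]
    rfl

/-- Multiplication of integer matrices of determinant `n` by `γ` from the right. -/
def mulRight (A : FixedDetMatrix (Fin 2) ℤ n) (γ : SL(2, ℤ)) : FixedDetMatrix (Fin 2) ℤ n :=
  ⟨A.1 * γ, by rw [Matrix.det_mul, A.2, γ.2, mul_one]⟩

lemma coe_mulRight (A : FixedDetMatrix (Fin 2) ℤ n) (γ : SL(2, ℤ)) :
    (mulRight A γ).1 = A.1 * (γ : Matrix (Fin 2) (Fin 2) ℤ) := rfl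

lemma mulRight_mulRight (A : FixedDetMatrix (Fin 2) ℤ n) (γ δ : SL(2, ℤ)) :
    mulRight (mulRight A γ) δ = mulRight A (γ * δ) :=
  Subtype.ext (mul_assoc _ _ _)

lemma mulRight_one (A : FixedDetMatrix (Fin 2) ℤ n) : mulRight A 1 = A :=
  Subtype.ext (mul_one _)

lemma smul_mulRight (A : FixedDetMatrix (Fin 2) ℤ n) (γ δ : SL(2, ℤ)) :
    δ • mulRight A γ = mulRight (δ • A) γ :=
  Subtype.ext (mul_assoc _ _ _).symm

/-- Equivalence classes of integer matrices of determinant `n` under multiplication by `SL₂(ℤ)` from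
the left. -/
abbrev MatrixClass (n : ℕ) : Type :=
  MulAction.orbitRel.Quotient SL(2, ℤ) (FixedDetMatrix (Fin 2) ℤ n)

namespace MatrixClass

/-- The class of a matrix. -/
def mk (A : FixedDetMatrix (Fin 2) ℤ n) : MatrixClass n := Quotient.mk'' A

lemma mk_eq_mk {A B : FixedDetMatrix (Fin 2) ℤ n} : mk A = mk B ↔ ∃ γ : SL(2, ℤ), γ • B = A :=
  Quotient.eq''.trans MulAction.orbitRel_apply

lemma mk_out (s : MatrixClass n) : mk s.out = s := Quotient.out_eq' s

instance [NeZero n] : Finite (MatrixClass n) := by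
  refine .of_surjective (fun A : FixedDetMatrices.reps (n : ℤ) => mk A.1) fun s => ?_
  obtain ⟨γ, hγ⟩ := exists_smul_mem_reps s.out
  exact ⟨⟨_, hγ⟩, (mk_eq_mk.mpr ⟨γ, rfl⟩).trans (mk_out s)⟩

instance [NeZero n] : Fintype (MatrixClass n) := Fintype.ofFinite _

lemma mk_mulRight_out (A : FixedDetMatrix (Fin 2) ℤ n) (γ : SL(2, ℤ)) :
    mk (mulRight (mk A).out γ) = mk (mulRight A γ) := by
  obtain ⟨δ, hδ⟩ := mk_eq_mk.mp (mk_out (mk A))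
  rw [← hδ, ← smul_mulRight]
  exact mk_eq_mk.mpr ⟨δ, rfl⟩

/-- The permutation of the classes given by multiplication by `γ` from the right. -/
def rightEquiv (γ : SL(2, ℤ)) : MatrixClass n ≃ MatrixClass n where
  toFun s := mk (mulRight s.out γ)
  invFun s := mk (mulRight s.out γ⁻¹)
  left_inv s := by
    dsimp only
    rw [mk_mulRight_out, mulRight_mulRight, mul_inv_cancel, mulRight_one, mk_out]
  right_inv s := by
    dsimp only
    rw [mk_mulRight_out, mulRight_mulRight, inv_mul_cancel, mulRight_one, mk_out]

end MatrixClass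

end IntegerMatrices

section ConjugateSystems

open Polynomial in
lemma coeff_prod_mem {R ι : Type*} [CommRing R] (A : Subring R) (s : Finset ι) {P : ι → R[X]}
    (hP : ∀ i ∈ s, ∀ k, (P i).coeff k ∈ A) (k : ℕ) : (∏ i ∈ s, P i).coeff k ∈ A := by
  have hlifts : ∀ {Q : R[X]}, Q ∈ lifts A.subtype ↔ ∀ k, Q.coeff k ∈ A := by
    simp [lifts_iff_coeff_lifts]
  exact hlifts.mp (prod_mem fun i hi => hlifts.mpr (hP i hi)) k

/-- The substitution `F ↦ F ∘ γ`. -/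
def pullback (γ : SL(2, ℤ)) : (ℍ → ℂ) →+* (ℍ → ℂ) := RingHom.pi fun z => Pi.evalRingHom _ (γ • z)

lemma mem_levelOne_of_pullback_eq {F : ℍ → ℂ} (hF : MDifferentiable 𝓘(ℂ) 𝓘(ℂ) F)
    (hF' : ∀ γ, pullback γ F = F) : F ∈ levelOne :=
  ⟨hF, fun γ => congrFun (hF' γ)⟩

/-- A family of functions, indexed by the integer matrices of determinant `n`, which depends only on
the classes of the matrices, is permuted by the modular group and has integral `q`-expansions: a
full set of conjugates over the level one functions. -/
structure IsConjugateSystem {n : ℕ} (g : FixedDetMatrix (Fin 2) ℤ n → ℍ → ℂ) : Prop where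
  smul_eq : ∀ (γ : SL(2, ℤ)) A, g (γ • A) = g A
  apply_smul : ∀ (γ : SL(2, ℤ)) A z, g A (γ • z) = g (mulRight A γ) z
  mem : ∀ A, g A ∈ integralRing n

namespace IsConjugateSystem

variable {n : ℕ} {f g : FixedDetMatrix (Fin 2) ℤ n → ℍ → ℂ}

lemma const {F : ℍ → ℂ} (hF : F ∈ integralRing n) (hF' : F ∈ levelOne) :
    IsConjugateSystem fun _ : FixedDetMatrix (Fin 2) ℤ n => F where
  smul_eq _ _ := rfl
  apply_smul γ _ z := hF'.2 γ z
  mem _ := hF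

lemma sub (hg : IsConjugateSystem g) (hf : IsConjugateSystem f) :
    IsConjugateSystem fun A => g A - f A where
  smul_eq γ A := by rw [hg.smul_eq, hf.smul_eq]
  apply_smul γ A z := by simp only [Pi.sub_apply, hg.apply_smul, hf.apply_smul]
  mem A := sub_mem (hg.mem A) (hf.mem A)

lemma out_mk (hg : IsConjugateSystem g) (A : FixedDetMatrix (Fin 2) ℤ n) :
    g (MatrixClass.mk A).out = g A := by
  obtain ⟨δ, hδ⟩ := MatrixClass.mk_eq_mk.mp (MatrixClass.mk_out (MatrixClass.mk A))
  rw [← hδ, hg.smul_eq]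

lemma pullback_out (hg : IsConjugateSystem g) (γ : SL(2, ℤ)) (s : MatrixClass n) :
    pullback γ (g s.out) = g (MatrixClass.rightEquiv γ s).out :=
  (funext fun z => hg.apply_smul γ s.out z).trans (hg.out_mk _).symm

variable [NeZero n]

lemma prod_mem_integralRing (hg : IsConjugateSystem g) :
    ∏ s : MatrixClass n, g s.out ∈ integralRing n :=
  prod_mem fun _ _ => hg.mem _

lemma prod_mem_levelOne (hg : IsConjugateSystem g) : ∏ s : MatrixClass n, g s.out ∈ levelOne := by
  refine mem_levelOne_of_pullback_eq hg.prod_mem_integralRing.1 fun γ => ?_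
  rw [map_prod, ← Equiv.prod_comp (MatrixClass.rightEquiv γ) fun s => g s.out]
  exact Finset.prod_congr rfl fun s _ => hg.pullback_out γ s

open Polynomial

/-- The characteristic polynomial `∏ (X - g_S)`, over the classes `S`, of a conjugate system. -/
def charPoly (g : FixedDetMatrix (Fin 2) ℤ n → ℍ → ℂ) : (ℍ → ℂ)[X] :=
  ∏ s : MatrixClass n, (X - C (g s.out))

lemma coeff_charPoly_mem_integralRing (hg : IsConjugateSystem g) (k : ℕ) :
    (charPoly g).coeff k ∈ integralRing n := by
  refine coeff_prod_mem _ _ (fun s _ k => ?_) k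
  rw [coeff_sub, coeff_X, coeff_C]
  refine sub_mem ?_ ?_ <;> split_ifs
  exacts [one_mem _, zero_mem _, hg.mem _, zero_mem _]

lemma map_pullback_charPoly (hg : IsConjugateSystem g) (γ : SL(2, ℤ)) :
    (charPoly g).map (pullback γ) = charPoly g := by
  rw [charPoly, Polynomial.map_prod,
    ← Equiv.prod_comp (MatrixClass.rightEquiv γ) fun s => X - C (g s.out)]
  refine Finset.prod_congr rfl fun s _ => ?_
  rw [Polynomial.map_sub, map_X, map_C, hg.pullback_out]

lemma coeff_charPoly_mem_levelOne (hg : IsConjugateSystem g) (k : ℕ) :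
    (charPoly g).coeff k ∈ levelOne :=
  mem_levelOne_of_pullback_eq (hg.coeff_charPoly_mem_integralRing k).1 fun γ => by
    rw [← coeff_map, hg.map_pullback_charPoly]

theorem isIntegral (hg : IsConjugateSystem g) (A : FixedDetMatrix (Fin 2) ℤ n) {z : ℍ}
    (hz : IsIntegral ℤ (j z)) : IsIntegral ℤ (g A z) := by
  let P : ℂ[X] := (charPoly g).map (Pi.evalRingHom (fun _ : ℍ => ℂ) z)
  have hP : P = ∏ s : MatrixClass n, (X - C (g s.out z)) := by
    simp only [P, charPoly, Polynomial.map_prod, Polynomial.map_sub, map_X, map_C,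
      Pi.evalRingHom_apply]
  have hroot : P.eval (g A z) = 0 := by
    rw [hP, eval_prod]
    refine Finset.prod_eq_zero (Finset.mem_univ (MatrixClass.mk A)) ?_
    rw [hg.out_mk, eval_sub, eval_X, eval_C, sub_self]
  refine .of_aeval_monic_of_isIntegral_coeff (p := P) ?_ ?_ (hroot ▸ isIntegral_zero) fun k => ?_
  · rw [hP]
    exact monic_prod_X_sub_C _ _
  · have : Nonempty (MatrixClass n) := ⟨MatrixClass.mk A⟩
    rw [hP, natDegree_finsetProd_X_sub_C_eq_card]
    exact Fintype.card_ne_zero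
  · rw [coeff_map]
    exact isIntegral_apply_of_isIntegral_j (hg.coeff_charPoly_mem_integralRing k)
      (hg.coeff_charPoly_mem_levelOne k) hz

end IsConjugateSystem

end ConjugateSystems

section UpperTriangular

lemma exists_unit_algebraMap_eq {x : ℂ} {k : ℕ} (hk : k ≠ 0) (hx : x ^ k = 1) :
    ∃ u : (𝓞 ℂ)ˣ, algebraMap (𝓞 ℂ) ℂ u = x := by
  have hint : IsIntegral ℤ x := .of_pow (Nat.pos_of_ne_zero hk) (hx ▸ isIntegral_one)
  obtain ⟨y, rfl⟩ := (IsIntegralClosure.isIntegral_iff (A := 𝓞 ℂ)).mp hint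
  rw [← map_pow, map_eq_one_iff _ (FaithfulSMul.algebraMap_injective (𝓞 ℂ) ℂ)] at hx
  exact ⟨Units.ofPowEqOne y k hx hk, rfl⟩

variable {n a d : ℕ} {b : ℤ}

lemma det_upper (a d : ℕ) (b : ℤ) : (!![(a : ℤ), b; 0, (d : ℤ)]).det = (a * d : ℕ) := by
  simp [Matrix.det_fin_two]

lemma det_upper_pos (ha : a ≠ 0) (hd : d ≠ 0) : 0 < (!![(a : ℤ), b; 0, (d : ℤ)]).det := by
  rw [det_upper]
  positivity

lemma coe_moebius_upper (ha : a ≠ 0) (hd : d ≠ 0) (z : ℍ) :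
    (moebius !![(a : ℤ), b; 0, (d : ℤ)] z : ℂ) = ((a : ℂ) * z + b) / d := by
  rw [coe_moebius _ (det_upper_pos ha hd)]
  simp

lemma im_moebius_upper (ha : a ≠ 0) (hd : d ≠ 0) (z : ℍ) :
    (moebius !![(a : ℤ), b; 0, (d : ℤ)] z).im = a / d * z.im := by
  have hreal : ((a : ℂ) * z + b) / d = ((a / d : ℝ) : ℂ) * z + ((b / d : ℝ) : ℂ) := by
    push_cast
    ring
  rw [← coe_im, coe_moebius_upper ha hd, hreal, Complex.add_im, Complex.im_ofReal_mul,
    Complex.ofReal_im, add_zero, coe_im]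

lemma tendsto_moebius_upper (ha : a ≠ 0) (hd : d ≠ 0) :
    Tendsto (moebius !![(a : ℤ), b; 0, (d : ℤ)]) atImInfty atImInfty := by
  rw [atImInfty, tendsto_comap_iff]
  exact (tendsto_comap.const_mul_atTop (by positivity)).congr fun z =>
    (im_moebius_upper ha hd z).symm

lemma qParam_moebius_upper (ha : a ≠ 0) (hd : d ≠ 0) (z : ℍ) :
    𝕢 1 (moebius !![(a : ℤ), b; 0, (d : ℤ)] z) =
      Complex.exp (2 * Real.pi * Complex.I * b / d) * 𝕢 (a * d : ℕ) z ^ a ^ 2 := by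
  have hd' : (d : ℂ) ≠ 0 := by exact_mod_cast hd
  rw [Function.Periodic.qParam, Function.Periodic.qParam, ← Complex.exp_nat_mul,
    ← Complex.exp_add, coe_moebius_upper ha hd]
  congr 1
  push_cast
  field_simp
  ring

lemma Expands.comp_upper (ha : a ≠ 0) (hd : d ≠ 0) (b : ℤ) {f : ℍ → ℂ} {N : ℤ}
    {c : PowerSeries (𝓞 ℂ)} (hf : Expands 1 f N c) :
    ∃ (ζ : (𝓞 ℂ)ˣ) (c' : PowerSeries (𝓞 ℂ)),
      Expands (a * d) (f ∘ moebius !![(a : ℤ), b; 0, (d : ℤ)]) ((a ^ 2 : ℕ) * N) c' ∧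
      PowerSeries.constantCoeff c' = ζ * PowerSeries.constantCoeff c := by
  have hd' : (d : ℂ) ≠ 0 := by exact_mod_cast hd
  obtain ⟨ζ, hζ⟩ := exists_unit_algebraMap_eq hd
    (show Complex.exp (2 * Real.pi * Complex.I * b / d) ^ d = 1 by
      rw [← Complex.exp_nat_mul, mul_div_cancel₀ _ hd', mul_comm]
      exact Complex.exp_int_mul_two_pi_mul_I b)
  refine ⟨ζ ^ (-N), _, hf.comp (pow_ne_zero 2 ha) (tendsto_moebius_upper ha hd) ζ fun z => ?_, ?_⟩
  · rw [hζ, qParam_moebius_upper ha hd]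
  · rw [map_mul, PowerSeries.constantCoeff_expand, PowerSeries.constantCoeff_C,
      ← PowerSeries.coeff_zero_eq_constantCoeff_apply, PowerSeries.coeff_rescale, pow_zero, one_mul,
      PowerSeries.coeff_zero_eq_constantCoeff_apply]

lemma IsConjugateSystem.of_upper_triangular [NeZero n] {g : FixedDetMatrix (Fin 2) ℤ n → ℍ → ℂ}
    (hsmul : ∀ (γ : SL(2, ℤ)) A, g (γ • A) = g A)
    (happly : ∀ (γ : SL(2, ℤ)) A z, g A (γ • z) = g (mulRight A γ) z)
    (hmem : ∀ (A : FixedDetMatrix (Fin 2) ℤ n) (a d : ℕ) (b : ℤ), a ≠ 0 → d ≠ 0 → a * d = n →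
      A.1 = !![(a : ℤ), b; 0, (d : ℤ)] → g A ∈ integralRing n) :
    IsConjugateSystem g where
  smul_eq := hsmul
  apply_smul := happly
  mem A := by
    obtain ⟨γ, a, d, b, ha, hd, had, hA⟩ := exists_smul_eq_upper_triangular A
    exact hsmul γ A ▸ hmem _ a d b ha hd had hA

end UpperTriangular

section SingularModuli

lemma isConjugateSystem_j_comp (n : ℕ) [NeZero n] :
    IsConjugateSystem fun A : FixedDetMatrix (Fin 2) ℤ n => j ∘ moebius A.1 := by
  refine .of_upper_triangular (fun γ A => funext fun z => ?_) (fun γ A z => ?_)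
    fun A a d b ha hd had hA =>
      ⟨mdifferentiable_j.comp (mdifferentiable_moebius (det_pos_of_fixedDet A)), ?_⟩
  · rw [Function.comp_apply, Function.comp_apply, FixedDetMatrices.smul_coe,
      moebius_mul (det_specialLinearGroup_pos γ) (det_pos_of_fixedDet A),
      moebius_specialLinearGroup, j_smul]
  · rw [Function.comp_apply, Function.comp_apply, mulRight,
      moebius_mul (det_pos_of_fixedDet A) (det_specialLinearGroup_pos γ),
      moebius_specialLinearGroup]
  · obtain ⟨c, hc, -⟩ := exists_expands_j (𝓞 ℂ)
    obtain ⟨ζ, c', hc', -⟩ := hc.comp_upper ha hd b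
    exact ⟨_, c', hA ▸ had ▸ hc'⟩

lemma isConjugateSystem_j_sub_j_comp (n : ℕ) [NeZero n] :
    IsConjugateSystem fun A : FixedDetMatrix (Fin 2) ℤ n => j - j ∘ moebius A.1 :=
  (IsConjugateSystem.const (j_mem_integralRing n) j_mem_levelOne).sub (isConjugateSystem_j_comp n)

lemma Expands.exists_sub_of_ne {A : Type*} [CommRing A] [Algebra A ℂ] {h M N : ℕ} {f g : ℍ → ℂ}
    {c d : PowerSeries A} (hf : Expands h f M c) (hg : Expands h g N d) (hMN : M ≠ N)
    (hc : IsUnit (PowerSeries.constantCoeff c)) (hd : IsUnit (PowerSeries.constantCoeff d)) :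
    ∃ (K : ℕ) (e : PowerSeries A), Expands h (f - g) K e ∧
      IsUnit (PowerSeries.constantCoeff e) := by
  rcases hMN.lt_or_gt with hlt | hlt <;> obtain ⟨k, rfl⟩ := Nat.exists_eq_add_of_lt hlt
  · refine ⟨_, _, .sub (by exact_mod_cast hf.shift (k + 1)) hg, ?_⟩
    simpa using hd
  · refine ⟨_, _, .sub hf (by exact_mod_cast hg.shift (k + 1)), ?_⟩
    simpa using hc

/-- For upper triangular `S` with diagonal `(a, d)`, the pole orders of `j` and `j ∘ S` in `q` are
`1` and `a / d`. -/
lemma exists_expands_j_sub_j_comp {n : ℕ} [NeZero n] (hn : ¬ IsSquare n)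
    (A : FixedDetMatrix (Fin 2) ℤ n) : ∃ (N : ℕ) (c : PowerSeries (𝓞 ℂ)),
      Expands n (j - j ∘ moebius A.1) N c ∧ IsUnit (PowerSeries.constantCoeff c) := by
  obtain ⟨γ, a, d, b, ha, hd, rfl, hA⟩ := exists_smul_eq_upper_triangular A
  obtain ⟨c, hc, hc0⟩ := exists_expands_j (𝓞 ℂ)
  obtain ⟨c₁, hc₁, hc₁0⟩ := hc.ramify (a * d)
  obtain ⟨ζ, c₂, hc₂, hc₂0⟩ := hc.comp_upper ha hd b
  rw [← (isConjugateSystem_j_sub_j_comp (a * d)).smul_eq γ A, hA]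
  rw [mul_one] at hc₁ hc₂
  refine hc₁.exists_sub_of_ne hc₂ (fun h => hn ⟨a, by rw [h, sq]⟩) ?_ ?_
  · rw [hc₁0, hc0]
    exact isUnit_one
  · rw [hc₂0, hc0, mul_one]
    exact ζ.isUnit

lemma Expands.isIntegral_j_of_eq_zero {h N : ℕ} [NeZero h] {F : ℍ → ℂ} {c : PowerSeries (𝓞 ℂ)}
    (hF : F ∈ levelOne) (hc : Expands h F N c) (hu : IsUnit (PowerSeries.constantCoeff c))
    {z : ℍ} (hz : F z = 0) : IsIntegral ℤ (j z) := by
  obtain ⟨u, hu⟩ := hu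
  have hc' := (Expands.const h ((u⁻¹ : (𝓞 ℂ)ˣ) : 𝓞 ℂ)).mul hc
  rw [zero_add] at hc'
  obtain ⟨Q, hQ, hQF⟩ := hc'.exists_monic_polynomial
    (mul_mem (levelOne.algebraMap_mem _) hF) (by simp [← hu])
  refine isIntegral_trans (A := 𝓞 ℂ) _ ⟨Q, hQ, ?_⟩
  rw [← Polynomial.aeval_def, ← hQF, Pi.mul_apply, hz, mul_zero]

theorem isIntegral_j_of_moebius_eq {n : ℕ} (hn : ¬ IsSquare n) {S : Matrix (Fin 2) (Fin 2) ℤ}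
    (hS : S.det = n) {z : ℍ} (hz : moebius S z = z) : IsIntegral ℤ (j z) := by
  have : NeZero n := ⟨fun h => hn (h ▸ IsSquare.zero)⟩
  have hsys := isConjugateSystem_j_sub_j_comp n
  choose N c hc hcu using fun s : MatrixClass n => exists_expands_j_sub_j_comp hn s.out
  have hprod := Expands.prod Finset.univ fun s _ => hc s
  rw [← Nat.cast_sum] at hprod
  refine hprod.isIntegral_j_of_eq_zero hsys.prod_mem_levelOne ?_ ?_
  · rw [map_prod]
    exact IsUnit.prod_univ_iff.mpr hcu
  · rw [Finset.prod_apply]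
    refine Finset.prod_eq_zero (Finset.mem_univ (MatrixClass.mk ⟨S, hS⟩)) ?_
    have hout := hsys.out_mk ⟨S, hS⟩
    dsimp only at hout
    rw [hout, Pi.sub_apply, Function.comp_apply, hz, sub_self]

lemma isIntegral_j_moebius {n : ℕ} [NeZero n] {S : Matrix (Fin 2) (Fin 2) ℤ} (hS : S.det = n)
    {z : ℍ} (hz : IsIntegral ℤ (j z)) : IsIntegral ℤ (j (moebius S z)) :=
  (isConjugateSystem_j_comp n).isIntegral ⟨S, hS⟩ hz

end SingularModuli

section Phi

variable {S T : Matrix (Fin 2) (Fin 2) ℤ}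

lemma phi_eq (hS : 0 < S.det) (z : ℍ) :
    phi S z = (S.det : ℂ) ^ 12 * ModularForm.discriminant (moebius S z) /
      (automorphyFactor S z ^ 12 * ModularForm.discriminant z) := by
  have hnum : deltaHom ((S 0 0 : ℂ) * z + S 0 1) ((S 1 0 : ℂ) * z + S 1 1) =
      (2 * Real.pi : ℂ) ^ 12 * ModularForm.discriminant (moebius S z) /
        automorphyFactor S z ^ 12 := by
    rw [deltaHom, ← coe_moebius S hS]
    rfl
  have hden : deltaHom z 1 = (2 * Real.pi : ℂ) ^ 12 * ModularForm.discriminant z := by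
    rw [deltaHom, div_one, one_pow, div_one]
    rfl
  have hpi : (Real.pi : ℂ) ≠ 0 := Complex.ofReal_ne_zero.mpr Real.pi_ne_zero
  have hΔ := ModularForm.discriminant_ne_zero z
  have hJ := automorphyFactor_ne_zero hS z
  rw [phi, hnum, hden]
  field_simp

lemma phi_ne_zero (hS : 0 < S.det) (z : ℍ) : phi S z ≠ 0 := by
  rw [phi_eq hS]
  exact div_ne_zero
    (mul_ne_zero (pow_ne_zero _ (Int.cast_ne_zero.mpr hS.ne')) (ModularForm.discriminant_ne_zero _))
    (mul_ne_zero (pow_ne_zero _ (automorphyFactor_ne_zero hS z))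
      (ModularForm.discriminant_ne_zero z))

lemma phi_mul (hS : 0 < S.det) (hT : 0 < T.det) (z : ℍ) :
    phi (S * T) z = phi S (moebius T z) * phi T z := by
  have hΔ := ModularForm.discriminant_ne_zero z
  have hΔT := ModularForm.discriminant_ne_zero (moebius T z)
  have hJT := automorphyFactor_ne_zero hT z
  have hJS := automorphyFactor_ne_zero hS (moebius T z)
  rw [phi_eq hS, phi_eq hT, phi_eq (det_mul_pos hS hT), moebius_mul hS hT,
    automorphyFactor_mul S hT, Matrix.det_mul]
  push_cast
  field_simp

lemma phi_specialLinearGroup (γ : SL(2, ℤ)) (z : ℍ) :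
    phi (γ : Matrix (Fin 2) (Fin 2) ℤ) z = 1 := by
  have hΔ := ModularForm.discriminant_ne_zero z
  have hJ := automorphyFactor_ne_zero (det_specialLinearGroup_pos γ) z
  rw [phi_eq (det_specialLinearGroup_pos γ), moebius_specialLinearGroup, discriminant_smul,
    Matrix.SpecialLinearGroup.det_coe, Int.cast_one, one_pow, one_mul]
  exact div_self (mul_ne_zero (pow_ne_zero _ hJ) hΔ)

lemma mdifferentiable_phi (hS : 0 < S.det) : MDifferentiable 𝓘(ℂ) 𝓘(ℂ) (phi S) := by
  rw [show phi S = _ from funext (phi_eq hS)]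
  exact (mdifferentiable_const.mul (mdifferentiable_discriminant.comp
    (mdifferentiable_moebius hS))).div
    (((mdifferentiable_automorphyFactor S).pow 12).mul mdifferentiable_discriminant) fun z =>
      mul_ne_zero (pow_ne_zero _ (automorphyFactor_ne_zero hS z))
        (ModularForm.discriminant_ne_zero z)

section

variable {n : ℕ} [NeZero n]

lemma phi_smul (γ : SL(2, ℤ)) (A : FixedDetMatrix (Fin 2) ℤ n) : phi (γ • A).1 = phi A.1 := by
  ext z
  rw [FixedDetMatrices.smul_coe, phi_mul (det_specialLinearGroup_pos γ) (det_pos_of_fixedDet A),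
    phi_specialLinearGroup, one_mul]

lemma phi_apply_smul (γ : SL(2, ℤ)) (A : FixedDetMatrix (Fin 2) ℤ n) (z : ℍ) :
    phi A.1 (γ • z) = phi (mulRight A γ).1 z := by
  rw [mulRight, phi_mul (det_pos_of_fixedDet A) (det_specialLinearGroup_pos γ),
    phi_specialLinearGroup, mul_one, moebius_specialLinearGroup]

end

variable {a d : ℕ}

lemma phi_upper (ha : a ≠ 0) (hd : d ≠ 0) (b : ℤ) : phi !![(a : ℤ), b; 0, (d : ℤ)] =
    (fun _ => (a : ℂ) ^ 12) * (ModularForm.discriminant ∘ moebius !![(a : ℤ), b; 0, (d : ℤ)] *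
      ModularForm.discriminant⁻¹) := by
  ext z
  have hd' : (d : ℂ) ≠ 0 := by exact_mod_cast hd
  have hJ : automorphyFactor !![(a : ℤ), b; 0, (d : ℤ)] z = d := by simp [automorphyFactor]
  have hΔ := ModularForm.discriminant_ne_zero z
  rw [phi_eq (det_upper_pos ha hd), det_upper, hJ, Pi.mul_apply, Pi.mul_apply, Pi.inv_apply,
    Function.comp_apply]
  push_cast
  field_simp

lemma exists_expands_phi_upper (ha : a ≠ 0) (hd : d ≠ 0) (b : ℤ) :
    ∃ (N : ℤ) (c : PowerSeries (𝓞 ℂ)), IsUnit (PowerSeries.constantCoeff c) ∧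
      Expands (a * d) (fun z => phi !![(a : ℤ), b; 0, (d : ℤ)] z / a ^ 12) N c := by
  have : NeZero (a * d) := ⟨mul_ne_zero ha hd⟩
  have ha' : (a : ℂ) ^ 12 ≠ 0 := pow_ne_zero _ (by exact_mod_cast ha)
  obtain ⟨c, hc, hc0⟩ := exists_expands_discriminant (𝓞 ℂ)
  obtain ⟨ζ, c₁, hc₁, hc₁0⟩ := hc.comp_upper ha hd b
  obtain ⟨c₂, hc₂, hc₂0⟩ := hc.ramify (a * d)
  obtain ⟨e, he⟩ := exists_mul_eq_one (hc₂0.trans hc0 ▸ isUnit_one)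
  refine ⟨(a ^ 2 : ℕ) * -1 + -((a * d : ℕ) * -1), c₁ * e, ?_, ?_⟩
  · rw [map_mul, hc₁0, hc0, mul_one]
    exact ζ.isUnit.mul ((IsUnit.of_mul_eq_one _ (mul_comm e c₂ ▸ he)).map _)
  · convert hc₁.mul (hc₂.inv he) using 1
    ext z
    rw [phi_upper ha hd, Pi.mul_apply, mul_div_cancel_left₀ _ ha']

lemma phi_upper_div_mem_integralRing (ha : a ≠ 0) (hd : d ≠ 0) (b : ℤ) :
    (fun z => phi !![(a : ℤ), b; 0, (d : ℤ)] z / a ^ 12) ∈ integralRing (a * d) := by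
  obtain ⟨N, c, -, hc⟩ := exists_expands_phi_upper ha hd b
  refine ⟨?_, N, c, hc⟩
  exact (mdifferentiable_phi (det_upper_pos ha hd)).div mdifferentiable_const fun _ =>
    pow_ne_zero _ (by exact_mod_cast ha)

lemma div_phi_upper_mem_integralRing (ha : a ≠ 0) (hd : d ≠ 0) (b : ℤ) :
    (fun z => (a : ℂ) ^ 12 / phi !![(a : ℤ), b; 0, (d : ℤ)] z) ∈ integralRing (a * d) := by
  have : NeZero (a * d) := ⟨mul_ne_zero ha hd⟩
  obtain ⟨N, c, hu, hc⟩ := exists_expands_phi_upper ha hd b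
  obtain ⟨e, he⟩ := exists_mul_eq_one hu
  refine ⟨mdifferentiable_const.div (mdifferentiable_phi (det_upper_pos ha hd))
    (phi_ne_zero (det_upper_pos ha hd)), -N, e, ?_⟩
  simpa only [Pi.inv_def, inv_div] using hc.inv he

lemma isConjugateSystem_phi (n : ℕ) [NeZero n] :
    IsConjugateSystem fun A : FixedDetMatrix (Fin 2) ℤ n => phi A.1 := by
  refine .of_upper_triangular phi_smul phi_apply_smul fun A a d b ha hd had hA => ?_
  have ha' : (a : ℂ) ^ 12 ≠ 0 := pow_ne_zero _ (by exact_mod_cast ha)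
  subst had
  convert mul_mem (const_mem_integralRing (a * d) ((isIntegral_natCast a).pow 12))
    (phi_upper_div_mem_integralRing ha hd b) using 1
  ext z
  rw [hA, Pi.mul_apply, mul_div_cancel₀ _ ha']

lemma isConjugateSystem_div_phi (n : ℕ) [NeZero n] :
    IsConjugateSystem fun (A : FixedDetMatrix (Fin 2) ℤ n) z => (n : ℂ) ^ 12 / phi A.1 z := by
  refine .of_upper_triangular (fun γ A => by rw [phi_smul]) (fun γ A z => by rw [phi_apply_smul])
    fun A a d b ha hd had hA => ?_
  subst had
  convert mul_mem (const_mem_integralRing (a * d) ((isIntegral_natCast d).pow 12))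
    (div_phi_upper_mem_integralRing ha hd b) using 1
  ext z
  rw [hA, Pi.mul_apply, ← mul_div_assoc, ← mul_pow, Nat.cast_mul, mul_comm (a : ℂ)]

lemma exists_eq_phi_and_mul_eq {n : ℕ} [NeZero n] (hS : S.det = n) {z : ℍ}
    (hz : IsIntegral ℤ (j z)) : ∃ x y : 𝓞 ℂ, (x : ℂ) = phi S z ∧ x * y = (n : 𝓞 ℂ) ^ 12 := by
  have hpos : 0 < S.det := det_pos_of_fixedDet ⟨S, hS⟩
  obtain ⟨x, hx⟩ := (IsIntegralClosure.isIntegral_iff (A := 𝓞 ℂ)).mp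
    ((isConjugateSystem_phi n).isIntegral ⟨S, hS⟩ hz)
  obtain ⟨y, hy⟩ := (IsIntegralClosure.isIntegral_iff (A := 𝓞 ℂ)).mp
    ((isConjugateSystem_div_phi n).isIntegral ⟨S, hS⟩ hz)
  refine ⟨x, y, hx, FaithfulSMul.algebraMap_injective (𝓞 ℂ) ℂ ?_⟩
  rw [map_mul, map_pow, map_natCast, hx, hy]
  exact mul_div_cancel₀ _ (phi_ne_zero hpos z)

end Phi

section EntireIntegralFunctions

lemma HasQExpansion.exists_expands {h : ℕ} {g : ℍ → ℂ} {a : ℤ → ℂ} (hg : HasQExpansion h g a)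
    (ha : ∀ ν, IsIntegral ℤ (a ν)) : ∃ (N : ℤ) (c : PowerSeries (𝓞 ℂ)), Expands h g N c := by
  obtain ⟨⟨n, hn⟩, ρ, hρ⟩ := hg
  choose b hb using fun ν => (IsIntegralClosure.isIntegral_iff (A := 𝓞 ℂ)).mp (ha ν)
  have hρ' : ∀ᶠ z : ℍ in atImInfty, ρ < z.im := tendsto_comap.eventually_gt_atTop ρ
  refine ⟨-n, PowerSeries.mk fun k => b (n + k), hρ'.mono fun z hz => ?_⟩
  have hq : 𝕢 (h : ℝ) z ≠ 0 := Function.Periodic.qParam_ne_zero _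
  have hshift : Function.Injective fun k : ℕ => n + (k : ℤ) := fun k l hkl => by simpa using hkl
  refine ((hshift.hasSum_iff fun ν hν => ?_).mpr
    ((hρ z hz).mul_left (𝕢 (h : ℝ) z ^ (-n)))).congr_fun fun k => ?_
  · have hνn : ν < n := by
      by_contra! hle
      exact hν ⟨(ν - n).toNat, by dsimp only; omega⟩
    rw [hn ν hνn, zero_mul, mul_zero]
  · rw [PowerSeries.coeff_mk, hb, Function.comp_apply, zpow_add₀ hq, zpow_neg, zpow_natCast]
    field_simp

lemma HasQExpansion.div_const {h : ℕ} {g : ℍ → ℂ} {a : ℤ → ℂ} (hg : HasQExpansion h g a) (k : ℂ) :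
    HasQExpansion h (fun z => g z / k) fun ν => a ν / k := by
  obtain ⟨⟨n, hn⟩, ρ, hρ⟩ := hg
  refine ⟨⟨n, fun ν hν => by simp only [hn ν hν, zero_div]⟩, ρ, fun z hz => ?_⟩
  exact ((hρ z hz).div_const k).congr_fun fun ν => (div_mul_eq_mul_div _ _ _)

lemma mdifferentiable_specialLinearGroup_smul (γ : SL(2, ℤ)) :
    MDifferentiable 𝓘(ℂ) 𝓘(ℂ) fun z : ℍ => γ • z := by
  simpa only [← funext (moebius_specialLinearGroup γ)] using
    mdifferentiable_moebius (det_specialLinearGroup_pos γ)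

lemma mdifferentiable_aeval (B : MvPolynomial (Fin 2) ℚ) {f g : ℍ → ℂ}
    (hf : MDifferentiable 𝓘(ℂ) 𝓘(ℂ) f) (hg : MDifferentiable 𝓘(ℂ) 𝓘(ℂ) g) :
    MDifferentiable 𝓘(ℂ) 𝓘(ℂ) fun z => MvPolynomial.aeval ![f z, g z] B := by
  induction B using MvPolynomial.induction_on with
  | C a => simpa only [MvPolynomial.aeval_C] using mdifferentiable_const
  | add p q hp hq =>
    simp only [map_add]
    exact hp.add hq
  | mul_X p i hp =>
    simp only [map_mul, MvPolynomial.aeval_X]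
    refine hp.mul ?_
    fin_cases i
    exacts [hf, hg]

section

variable {n : ℕ} {P A : FixedDetMatrix (Fin 2) ℤ n} {f g g' : ℍ → ℂ}

lemma isConjugate_iff : IsConjugate P.1 f A.1 g ↔
    ∃ M N : SL(2, ℤ), mulRight P M = N • A ∧ ∀ z, g z = f (M • z) :=
  exists₂_congr fun M N =>
    and_congr_left' (Subtype.ext_iff (a1 := mulRight P M) (a2 := N • A)).symm

variable [NeZero n]

lemma MemRationalField.apply_smul (hf : MDifferentiable 𝓘(ℂ) 𝓘(ℂ) f)
    (hmem : MemRationalField P.1 f) {M N : SL(2, ℤ)} (hMN : mulRight P M = N • P) (z : ℍ) :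
    f (M • z) = f z := by
  obtain ⟨A, B, ⟨w, hw⟩, hAB⟩ := hmem
  have hsys := isConjugateSystem_j_comp n
  have hj : ∀ z, j (moebius P.1 (M • z)) = j (moebius P.1 z) := fun z =>
    (hsys.apply_smul M P z).trans (congrFun (hMN ▸ hsys.smul_eq N P) z)
  have hB := mdifferentiable_aeval B mdifferentiable_j (hsys.mem P).1
  have hdiff : MDifferentiable 𝓘(ℂ) 𝓘(ℂ) ((fun z => f (M • z)) - f) :=
    (hf.comp (mdifferentiable_specialLinearGroup_smul M)).sub hf
  have hzero : ((fun z => f (M • z)) - f) *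
      (fun z => MvPolynomial.aeval ![j z, (j ∘ moebius P.1) z] B) = 0 := by
    ext z
    have hMz := hAB (M • z)
    rw [j_smul, hj, ← hAB z] at hMz
    rw [Pi.mul_apply, Pi.sub_apply, sub_mul]
    exact sub_eq_zero.mpr hMz
  rcases (mul_eq_zero_iff hdiff hB).mp hzero with h | h
  · exact sub_eq_zero.mp (congrFun h z)
  · exact absurd (congrFun h w) hw

lemma IsConjugate.unique (hf : MDifferentiable 𝓘(ℂ) 𝓘(ℂ) f) (hmem : MemRationalField P.1 f)
    (hg : IsConjugate P.1 f A.1 g) (hg' : IsConjugate P.1 f A.1 g') : g = g' := by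
  obtain ⟨M, N, hMN, h⟩ := isConjugate_iff.mp hg
  obtain ⟨M', N', hMN', h'⟩ := isConjugate_iff.mp hg'
  have hstab : mulRight P (M' * M⁻¹) = (N' * N⁻¹) • P := by
    rw [← mulRight_mulRight, hMN', eq_inv_smul_iff.mpr hMN.symm, smul_mulRight, smul_mulRight,
      mulRight_mulRight, mul_inv_cancel, mulRight_one, mul_smul]
  ext z
  rw [h z, h' z, ← hmem.apply_smul hf hstab (M • z), mul_smul, inv_smul_smul]

end

section PrimeDeterminant

/-- The matrix `diag(n, 1)`. -/
def scaling (n : ℕ) : FixedDetMatrix (Fin 2) ℤ n := ⟨!![(n : ℤ), 0; 0, 1], by simp⟩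

lemma upper_eq_T_zpow_smul_scaling (n : ℕ) (b : ℤ) :
    !![(n : ℤ), b; 0, (1 : ℕ)] = (ModularGroup.T ^ b • scaling n).1 := by
  rw [FixedDetMatrices.smul_coe, ModularGroup.coe_T_zpow]
  simp [scaling]

lemma upper_eq_S_smul_mulRight_scaling (n : ℕ) (b : ℤ) : !![((1 : ℕ) : ℤ), b; 0, (n : ℤ)] =
    (ModularGroup.S • mulRight (scaling n) (ModularGroup.S⁻¹ * ModularGroup.T ^ b)).1 := by
  rw [FixedDetMatrices.smul_coe, coe_mulRight, Matrix.SpecialLinearGroup.coe_mul,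
    ModularGroup.coe_T_zpow, Matrix.SpecialLinearGroup.coe_inv]
  simp [scaling, ModularGroup.S, Matrix.adjugate_fin_two]

variable {p : ℕ}

lemma eq_one_and_eq_or_of_mul_eq_prime (hp : p.Prime) {a d : ℕ} (had : a * d = p) :
    (a = 1 ∧ d = p) ∨ (a = p ∧ d = 1) := by
  rcases Nat.prime_mul_iff.mp (had ▸ hp) with ⟨-, rfl⟩ | ⟨-, rfl⟩ <;> simp_all

lemma exists_eq_smul_mulRight_scaling (hp : p.Prime) (A : FixedDetMatrix (Fin 2) ℤ p) :
    ∃ M N : SL(2, ℤ), A = N • mulRight (scaling p) M := by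
  have : NeZero p := ⟨hp.ne_zero⟩
  obtain ⟨γ, a, d, b, -, -, had, hA⟩ := exists_smul_eq_upper_triangular A
  rcases eq_one_and_eq_or_of_mul_eq_prime hp had with ⟨rfl, rfl⟩ | ⟨rfl, rfl⟩
  · refine ⟨ModularGroup.S⁻¹ * ModularGroup.T ^ b, γ⁻¹ * ModularGroup.S, ?_⟩
    rw [mul_smul, eq_inv_smul_iff]
    exact Subtype.ext (hA.trans (upper_eq_S_smul_mulRight_scaling _ b))
  · refine ⟨1, γ⁻¹ * ModularGroup.T ^ b, ?_⟩
    rw [mulRight_one, mul_smul, eq_inv_smul_iff]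
    exact Subtype.ext (hA.trans (upper_eq_T_zpow_smul_scaling _ b))

lemma exists_mulRight_eq_smul (hp : p.Prime) (A B : FixedDetMatrix (Fin 2) ℤ p) :
    ∃ M N : SL(2, ℤ), mulRight A M = N • B := by
  obtain ⟨M, N, rfl⟩ := exists_eq_smul_mulRight_scaling hp A
  obtain ⟨M', N', rfl⟩ := exists_eq_smul_mulRight_scaling hp B
  refine ⟨M⁻¹ * M', N * N'⁻¹, ?_⟩
  rw [← smul_mulRight, mulRight_mulRight, mul_inv_cancel_left, smul_smul, inv_mul_cancel_right]

lemma IsEntireIntegral.exists_isConjugateSystem (hp : p.Prime) {P : FixedDetMatrix (Fin 2) ℤ p}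
    {f : ℍ → ℂ} (hf : IsEntireIntegral p P.1 f) :
    ∃ F : FixedDetMatrix (Fin 2) ℤ p → ℍ → ℂ, IsConjugateSystem F ∧
      ∀ A g, IsConjugate P.1 f A.1 g ↔ g = F A := by
  have : NeZero p := ⟨hp.ne_zero⟩
  choose M N hMN using exists_mulRight_eq_smul hp P
  have hconj : ∀ A, IsConjugate P.1 f A.1 fun z => f (M A • z) := fun A =>
    isConjugate_iff.mpr ⟨M A, N A, hMN A, fun _ => rfl⟩
  have huniq : ∀ A g, IsConjugate P.1 f A.1 g ↔ g = fun z => f (M A • z) := fun A g =>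
    ⟨fun hg => hg.unique hf.holomorphic hf.mem (hconj A), fun hg => hg ▸ hconj A⟩
  refine ⟨fun A z => f (M A • z), ⟨fun γ A => ?_, fun γ A z => ?_, fun A => ?_⟩, huniq⟩
  · refine (huniq A _).mp (isConjugate_iff.mpr ⟨M (γ • A), N (γ • A) * γ, ?_, fun _ => rfl⟩)
    rw [hMN, mul_smul]
  · refine congrFun ((huniq (mulRight A γ) fun z => f (M A • γ • z)).mp
      (isConjugate_iff.mpr ⟨M A * γ, N A, ?_, fun z => by rw [mul_smul]⟩)) z
    rw [← mulRight_mulRight, hMN, smul_mulRight]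
  · obtain ⟨a, ha, hint⟩ := hf.integral _ _ (hconj A)
    exact ⟨hf.holomorphic.comp (mdifferentiable_specialLinearGroup_smul _), ha.exists_expands hint⟩

lemma div_const_mem_integralRing {h : ℕ} [NeZero h] {F : ℍ → ℂ} (hF : F ∈ integralRing h)
    {a : ℤ → ℂ} (ha : HasQExpansion 1 F a) {k : ℂ} (hk : k ≠ 0)
    (hdvd : ∀ ν, ∃ c : ℂ, IsIntegral ℤ c ∧ a ν = k * c) : (fun z => F z / k) ∈ integralRing h := by
  have hint : ∀ ν, IsIntegral ℤ (a ν / k) := fun ν => by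
    obtain ⟨c, hc, hac⟩ := hdvd ν
    rwa [hac, mul_div_cancel_left₀ _ hk]
  obtain ⟨N, c, hc⟩ := (ha.div_const k).exists_expands hint
  obtain ⟨d, hd, -⟩ := hc.ramify h
  exact ⟨hF.1.div mdifferentiable_const fun _ => hk, _, d, hd⟩

/-- On the class of `diag(p, 1)` the factor `p` is split off `F`, and on all other classes off
`p ^ 12 / φ`. -/
lemma IsConjugateSystem.mul_div_phi_div (hp : p.Prime) {F : FixedDetMatrix (Fin 2) ℤ p → ℍ → ℂ}
    (hF : IsConjugateSystem F) (hscaling : (fun z => F (scaling p) z / p) ∈ integralRing p) :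
    IsConjugateSystem fun A z => F A z * ((p : ℂ) ^ 12 / phi A.1 z) / p := by
  have : NeZero p := ⟨hp.ne_zero⟩
  have hp' : (p : ℂ) ≠ 0 := by exact_mod_cast hp.ne_zero
  refine .of_upper_triangular (fun γ A => by rw [hF.smul_eq, phi_smul])
    (fun γ A z => by rw [hF.apply_smul, phi_apply_smul]) fun A a d b ha hd had hA => ?_
  have hphi := div_phi_upper_mem_integralRing ha hd b
  rw [← hA, had] at hphi
  rcases eq_one_and_eq_or_of_mul_eq_prime hp had with ⟨rfl, rfl⟩ | ⟨rfl, rfl⟩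
  · convert mul_mem (mul_mem (hF.mem A)
      (const_mem_integralRing d ((isIntegral_natCast d).pow 11))) hphi using 1
    ext z
    simp only [Pi.mul_apply]
    field_simp
    ring
  · have hFA : F A = F (scaling a) :=
      (congrArg F (Subtype.ext (hA.trans (upper_eq_T_zpow_smul_scaling a b)))).trans
        (hF.smul_eq _ _)
    convert mul_mem hscaling hphi using 1
    ext z
    rw [hFA, Pi.mul_apply, div_mul_eq_mul_div]

theorem IsEntireIntegral.exists_mul_eq (hp : p.Prime) {P P' : FixedDetMatrix (Fin 2) ℤ p}
    {f g : ℍ → ℂ} (hf : IsEntireIntegral p P.1 f)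
    (hdvd : ∀ g, IsConjugate P.1 f !![(p : ℤ), 0; 0, 1] g → ∃ a : ℤ → ℂ, HasQExpansion 1 g a ∧
      ∀ ν, ∃ c : ℂ, IsIntegral ℤ c ∧ a ν = p * c)
    (hg : IsConjugate P.1 f P'.1 g) {z : ℍ} (hz : IsIntegral ℤ (j z)) :
    ∃ x y w r : 𝓞 ℂ, (x : ℂ) = phi P'.1 z ∧ x * y = (p : 𝓞 ℂ) ^ 12 ∧ (w : ℂ) = g z ∧
      w * y = p * r := by
  have : NeZero p := ⟨hp.ne_zero⟩
  have hp' : (p : ℂ) ≠ 0 := by exact_mod_cast hp.ne_zero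
  obtain ⟨F, hF, hconj⟩ := hf.exists_isConjugateSystem hp
  obtain rfl := (hconj _ _).mp hg
  obtain ⟨a, ha, hpa⟩ := hdvd _ ((hconj (scaling p) _).mpr rfl)
  have hquot := hF.mul_div_phi_div hp (div_const_mem_integralRing (hF.mem _) ha hp' hpa)
  obtain ⟨w, hw⟩ := (IsIntegralClosure.isIntegral_iff (A := 𝓞 ℂ)).mp (hF.isIntegral P' hz)
  obtain ⟨r, hr⟩ := (IsIntegralClosure.isIntegral_iff (A := 𝓞 ℂ)).mp (hquot.isIntegral P' hz)
  obtain ⟨x, y, hx, hxy⟩ := exists_eq_phi_and_mul_eq P'.2 hz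
  refine ⟨x, y, w, r, hx, hxy, hw, FaithfulSMul.algebraMap_injective (𝓞 ℂ) ℂ ?_⟩
  have hy : algebraMap (𝓞 ℂ) ℂ y = (p : ℂ) ^ 12 / phi P'.1 z := by
    have hφ := phi_ne_zero (det_pos_of_fixedDet P') z
    rw [eq_div_iff hφ, ← hx, mul_comm, ← map_mul, hxy, map_pow, map_natCast]
  rw [map_mul, map_mul, map_natCast, hw, hr, hy, mul_div_cancel₀ _ hp']

end PrimeDeterminant

end EntireIntegralFunctions

section IdealFactorizations

lemma eq_span_singleton_sup_span_singleton {O : Type*} [CommRing O] {I J E : Ideal O} {a l : O}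
    (hIJ : I * J = Ideal.span {a}) (hl : Ideal.span {l} = I * E)
    (hE : IsCoprime E (Ideal.span {a})) : I = Ideal.span {l} ⊔ Ideal.span {a} := by
  have htop : E ⊔ J = ⊤ :=
    top_le_iff.mp (hE.sup_eq.symm.le.trans (sup_le_sup_left (hIJ ▸ Ideal.mul_le_right) _))
  rw [hl, ← hIJ, ← Ideal.mul_sup, htop, Ideal.mul_top]

lemma eq_of_mul_eq_mul_of_isCoprime {O : Type*} [CommRing O] {I I' J J' Q : Ideal O} (hI : Q ≤ I)
    (hI' : Q ≤ I') (hJ : IsCoprime J Q) (hJ' : IsCoprime J' Q) (h : I * J = I' * J') : I = I' := by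
  have eq_mul_sup {Z W : Ideal O} (hZ : Q ≤ Z) (hW : IsCoprime W Q) : Z = Z * W ⊔ Q := by
    refine le_antisymm ?_ (sup_le Ideal.mul_le_left hZ)
    calc Z = Z * (W ⊔ Q) := by rw [hW.sup_eq, Ideal.mul_top]
      _ = Z * W ⊔ Z * Q := Ideal.mul_sup _ _ _
      _ ≤ Z * W ⊔ Q := sup_le_sup_left Ideal.mul_le_right _
  rw [eq_mul_sup hI hJ, eq_mul_sup hI' hJ', h]

/-- Both sides divide `a ^ k`, and they agree up to ideals coprime to `a`. -/
lemma span_singleton_eq_pow {O : Type*} [CommRing O] [IsDomain O] {I J E : Ideal O}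
    {a b l x y : O} {k : ℕ} (ha : a ≠ 0) (hIJ : I * J = Ideal.span {a})
    (hl : Ideal.span {l} = I * E) (hE : IsCoprime E (Ideal.span {a})) (hab : IsCoprime b a)
    (hx : x ∣ a ^ k) (hy : y ∣ b ^ k) (h : x * y * l ^ k = a ^ k * b ^ k) :
    Ideal.span {x} = J ^ k := by
  have hQ : Ideal.span {a ^ k} = I ^ k * J ^ k := by
    rw [← mul_pow, hIJ, Ideal.span_singleton_pow]
  have hb : IsCoprime (Ideal.span {b ^ k}) (Ideal.span {a ^ k}) :=
    (Ideal.isCoprime_span_singleton_iff _ _).mpr hab.pow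
  have hyE : IsCoprime (Ideal.span {y} * E ^ k) (Ideal.span {a ^ k}) := by
    refine .mul_left ?_ (Ideal.span_singleton_pow a k ▸ hE.pow)
    exact (Ideal.isCoprime_span_singleton_iff _ _).mpr (hab.pow.of_isCoprime_of_dvd_left hy)
  refine eq_of_mul_eq_mul_of_isCoprime ((Ideal.span_singleton_le_span_singleton).mpr hx)
    (hQ ▸ Ideal.mul_le_right) hyE hb ((Ideal.span_singleton_mul_right_inj (pow_ne_zero k ha)).mp ?_)
  calc Ideal.span {a ^ k} * (Ideal.span {x} * (Ideal.span {y} * E ^ k))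
      = J ^ k * (Ideal.span {x} * Ideal.span {y} * (I * E) ^ k) := by rw [hQ, mul_pow]; ring
    _ = J ^ k * (Ideal.span {a ^ k} * Ideal.span {b ^ k}) := by
        simp only [← hl, Ideal.span_singleton_pow, Ideal.span_singleton_mul_span_singleton, h]
    _ = Ideal.span {a ^ k} * (J ^ k * Ideal.span {b ^ k}) := by ring

lemma mem_of_mul_eq_mul_of_isCoprime {O : Type*} [CommRing O] [IsDomain O] {I J : Ideal O}
    {a r w x y : O} {k : ℕ} (ha : a ≠ 0) (hIJ : I * J = Ideal.span {a}) (hcop : IsCoprime I J)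
    (hx : Ideal.span {x} = I ^ k) (hxy : x * y = a ^ k) (hwy : w * y = a * r) : w ∈ I := by
  have hx0 : x ≠ 0 := left_ne_zero_of_mul (hxy ▸ pow_ne_zero k ha)
  have hy : Ideal.span {y} = J ^ k := by
    refine (Ideal.span_singleton_mul_right_inj hx0).mp ?_
    rw [Ideal.span_singleton_mul_span_singleton, hxy, hx, ← mul_pow, hIJ, Ideal.span_singleton_pow]
  have haI : a ∈ I := Ideal.mul_le_left (hIJ ▸ Ideal.mem_span_singleton_self a)
  obtain ⟨c, hc, d, hd, hcd⟩ := Ideal.isCoprime_iff_exists.mp (hy ▸ hcop.pow_right (n := k))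
  obtain ⟨s, rfl⟩ := Ideal.mem_span_singleton.mp hd
  rw [show w = w * c + s * r * a by linear_combination (-w) * hcd + s * hwy]
  exact add_mem (I.mul_mem_left _ hc) (I.mul_mem_left _ haI)

variable {O : Type*} [CommRing O] [IsDedekindDomain O] {I J J' : Ideal O}

lemma not_le_mul (hI : I ≠ ⊥) (hJ : J ≠ ⊤) : ¬ I ≤ I * J := fun h =>
  hJ (Ideal.one_eq_top (R := O) ▸ (mul_eq_left₀ hI).mp (le_antisymm Ideal.mul_le_left h))

lemma exists_mem_notMem_mul (hI : I ≠ ⊥) (hJ : J ≠ ⊤) (hJ' : J' ≠ ⊤) :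
    ∃ x ∈ I, x ∉ I * J ∧ x ∉ I * J' := by
  by_contra! h
  have hunion : (I : Set O) ⊆ (I * J : Ideal O) ∪ (I * J' : Ideal O) := fun x hx =>
    or_iff_not_imp_left.mpr (h x hx)
  exact (Ideal.subset_union.mp hunion).elim (not_le_mul hI hJ) (not_le_mul hI hJ')

lemma exists_span_singleton_eq_mul (hI : I ≠ ⊥) (hJ : J.IsMaximal) (hJ' : J'.IsMaximal) :
    ∃ x E, Ideal.span {x} = I * E ∧ IsCoprime E (J * J') := by
  obtain ⟨x, hxI, hxJ, hxJ'⟩ := exists_mem_notMem_mul hI hJ.ne_top hJ'.ne_top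
  obtain ⟨E, hE⟩ := Ideal.dvd_span_singleton.mpr hxI
  have hxE : x ∈ I * E := hE ▸ Ideal.mem_span_singleton_self x
  have isCoprime {M : Ideal O} (hM : M.IsMaximal) (hx : x ∉ I * M) : IsCoprime E M :=
    Ideal.isCoprime_iff_sup_eq.mpr <| (hM.out.le_iff.mp le_sup_right).resolve_right fun h =>
      hx (Ideal.mul_mono_right (le_sup_left.trans h.le) hxE)
  exact ⟨x, E, hE, (isCoprime hJ hxJ).mul_right (isCoprime hJ' hxJ')⟩

end IdealFactorizations

section QuadraticField

variable {K : Type*} [Field K] {p : ℕ} {𝔭 𝔭bar : Ideal (𝓞 K)}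

lemma exists_eq_mul_add_natCast_mul (hp : p.Prime) (hsplit : 𝔭 * 𝔭bar = Ideal.span {(p : 𝓞 K)})
    {R : Subalgebra ℤ (𝓞 K)} {c : ℤ} (hc : ¬ (p : ℤ) ∣ c) (hcR : (c : 𝓞 K) ∈ conductor R)
    {l : 𝓞 K} {𝔢 : Ideal (𝓞 K)} (hl : Ideal.span {l} = 𝔭 * 𝔢)
    (hcop : IsCoprime 𝔢 (Ideal.span {(p : 𝓞 K)})) {x : 𝓞 K} (hxR : x ∈ R) (hx : x ∈ 𝔭) :
    ∃ y ∈ R, ∃ z ∈ R, x = l * y + p * z := by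
  rw [eq_span_singleton_sup_span_singleton hsplit hl hcop, Submodule.mem_sup] at hx
  obtain ⟨_, hy, _, hz, rfl⟩ := hx
  obtain ⟨y, rfl⟩ := Ideal.mem_span_singleton.mp hy
  obtain ⟨z, rfl⟩ := Ideal.mem_span_singleton.mp hz
  obtain ⟨t, s, hst⟩ := (Nat.prime_iff_prime_int.mp hp).coprime_iff_not_dvd.mpr hc
  have hst' : (t : 𝓞 K) * p + s * c = 1 := by exact_mod_cast congrArg (Int.cast : ℤ → 𝓞 K) hst
  refine ⟨s * (c * y), R.mul_mem (R.intCast_mem s) (hcR y), s * (c * z) + t * (l * y + p * z),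
    R.add_mem (R.mul_mem (R.intCast_mem s) (hcR z)) (R.mul_mem (R.intCast_mem t) hxR), ?_⟩
  linear_combination (-(l * y + p * z)) * hst'

variable [NumberField K]

lemma absNorm_span_natCast (n : ℕ) :
    Ideal.absNorm (Ideal.span {(n : 𝓞 K)}) = n ^ Module.finrank ℚ K := by
  rw [Ideal.absNorm_span_natCast, NumberField.RingOfIntegers.rank]

lemma not_isUnit_natCast_of_prime (hp : p.Prime) : ¬ IsUnit (p : 𝓞 K) := fun h => by
  have hnorm := absNorm_span_natCast (K := K) p
  rw [Ideal.span_singleton_eq_top.mpr h, Ideal.absNorm_top] at hnorm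
  exact hp.ne_one ((Nat.pow_eq_one.mp hnorm.symm).resolve_right Module.finrank_pos.ne')

lemma absNorm_eq_of_mul_eq (hK : Module.finrank ℚ K = 2) (hp : p.Prime) (h𝔭 : 𝔭 ≠ ⊤)
    (h𝔭bar : 𝔭bar ≠ ⊤) (hsplit : 𝔭 * 𝔭bar = Ideal.span {(p : 𝓞 K)}) : Ideal.absNorm 𝔭 = p := by
  have hnorm : Ideal.absNorm 𝔭 * Ideal.absNorm 𝔭bar = p ^ 2 := by
    rw [← map_mul, hsplit, absNorm_span_natCast, hK]
  exact ((hp.mul_eq_prime_sq_iff (mt Ideal.absNorm_eq_one_iff.mp h𝔭)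
    (mt Ideal.absNorm_eq_one_iff.mp h𝔭bar)).mp hnorm).1

lemma not_dvd_absNorm_of_isCoprime (hp : p.Prime) {I : Ideal (𝓞 K)}
    (hI : IsCoprime I (Ideal.span {(p : 𝓞 K)})) : ¬ p ∣ Ideal.absNorm I := fun hdvd => by
  obtain ⟨M, hM, hMp, hMI⟩ := Ideal.exists_isMaximal_dvd_of_dvd_absNorm' hp I hdvd
  have hpM : (p : 𝓞 K) ∈ M := by
    have : (p : ℤ) ∈ M.under ℤ := hMp ▸ Ideal.mem_span_singleton_self _
    simpa [Ideal.under_def] using this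
  refine hM.ne_top (top_le_iff.mp (hI.sup_eq.symm.le.trans (sup_le (Ideal.le_of_dvd hMI) ?_)))
  exact (Ideal.span_singleton_le_iff_mem _).mpr hpM

lemma exists_forall_eq_intCast_add_mul (hK : Module.finrank ℚ K = 2) :
    ∃ ω : 𝓞 K, ∀ y : 𝓞 K, ∃ s t : ℤ, y = s + t * ω := by
  let b := Module.finBasisOfFinrankEq ℤ (𝓞 K) ((NumberField.RingOfIntegers.rank K).trans hK)
  have hb (y : 𝓞 K) : ∃ s t : ℤ, y = s * b 0 + t * b 1 :=
    ⟨b.repr y 0, b.repr y 1, by simpa [Fin.sum_univ_two] using (b.sum_repr y).symm⟩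
  obtain ⟨m, n, hmn⟩ := hb 1
  have hcop : IsCoprime m n := by
    rw [Int.isCoprime_iff_gcd_eq_one]
    by_contra hne
    obtain ⟨q, hq, hqd⟩ := Nat.exists_prime_and_dvd hne
    obtain ⟨m', rfl⟩ := (Int.natCast_dvd_natCast.mpr hqd).trans (Int.gcd_dvd_left m n)
    obtain ⟨n', rfl⟩ := (Int.natCast_dvd_natCast.mpr hqd).trans (Int.gcd_dvd_right _ n)
    refine not_isUnit_natCast_of_prime (K := K) hq (.of_mul_eq_one (m' * b 0 + n' * b 1) ?_)
    rw [hmn]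
    push_cast
    ring
  obtain ⟨u, v, huv⟩ := hcop
  have huv' : (u : 𝓞 K) * m + v * n = 1 := by exact_mod_cast congrArg (Int.cast : ℤ → 𝓞 K) huv
  refine ⟨-v * b 0 + u * b 1, fun y => ?_⟩
  obtain ⟨s, t, rfl⟩ := hb y
  refine ⟨s * u + t * v, -s * n + t * m, ?_⟩
  push_cast
  linear_combination (-((s : 𝓞 K) * u + t * v)) * hmn - ((s : 𝓞 K) * b 0 + t * b 1) * huv'

/-- If `a + bω` lies in the conductor, then so do the integers `b` and `a + bt`, where
`ω² = s + tω`. -/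
lemma exists_intCast_mem_conductor (hK : Module.finrank ℚ K = 2) {R : Subalgebra ℤ (𝓞 K)}
    (hcond : ¬ Ideal.span {(p : 𝓞 K)} ∣ conductor R) :
    ∃ c : ℤ, ¬ (p : ℤ) ∣ c ∧ (c : 𝓞 K) ∈ conductor R := by
  obtain ⟨ω, hω⟩ := exists_forall_eq_intCast_add_mul hK
  rw [Ideal.dvd_iff_le, SetLike.not_le_iff_exists] at hcond
  obtain ⟨x, hx, hxp⟩ := hcond
  obtain ⟨a, b, rfl⟩ := hω x
  obtain ⟨s, t, hst⟩ := hω (ω * ω)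
  have mem_conductor (c : ℤ) (hc : (c : 𝓞 K) * ω ∈ R) : (c : 𝓞 K) ∈ conductor R := fun y => by
    obtain ⟨m, n, rfl⟩ := hω y
    rw [show (c : 𝓞 K) * (m + n * ω) = ((c * m : ℤ) : 𝓞 K) + n * (c * ω) by push_cast; ring]
    exact R.add_mem (R.intCast_mem _) (R.mul_mem (R.intCast_mem n) hc)
  have hb : (b : 𝓞 K) * ω ∈ R := by
    convert R.sub_mem (hx 1) (R.intCast_mem a) using 1
    ring
  have hab : ((a + b * t : ℤ) : 𝓞 K) * ω ∈ R := by
    convert R.sub_mem (hx ω) (R.intCast_mem (b * s)) using 1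
    push_cast
    linear_combination (-(b : 𝓞 K)) * hst
  by_cases hpb : (p : ℤ) ∣ b
  · refine ⟨a + b * t, fun h => hxp ?_, mem_conductor _ hab⟩
    obtain ⟨a', rfl⟩ := (Int.dvd_add_left (hpb.mul_right t)).mp h
    obtain ⟨b', rfl⟩ := hpb
    exact Ideal.mem_span_singleton.mpr ⟨a' + b' * ω, by push_cast; ring⟩
  · exact ⟨b, hpb, mem_conductor _ hb⟩

lemma exists_mem_span_singleton_eq_mul (hp : p.Prime) (h𝔭 : 𝔭.IsMaximal) (h𝔭bar : 𝔭bar.IsMaximal)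
    (hsplit : 𝔭 * 𝔭bar = Ideal.span {(p : 𝓞 K)}) {R : Subalgebra ℤ (𝓞 K)} {c : ℤ}
    (hc : ¬ (p : ℤ) ∣ c) (hcR : (c : 𝓞 K) ∈ conductor R) :
    ∃ l ∈ R, ∃ 𝔢 : Ideal (𝓞 K), Ideal.span {l} = 𝔭 * 𝔢 ∧
      IsCoprime 𝔢 (Ideal.span {(p : 𝓞 K)}) := by
  have hne : 𝔭 * 𝔭bar ≠ ⊥ := by
    simpa [hsplit, Ideal.span_singleton_eq_bot] using hp.ne_zero
  obtain ⟨x, E, hxE, hE⟩ := exists_span_singleton_eq_mul (left_ne_zero_of_mul hne) h𝔭 h𝔭bar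
  have hcp : IsCoprime (c : 𝓞 K) (p : 𝓞 K) := by
    simpa using ((Nat.prime_iff_prime_int.mp hp).coprime_iff_not_dvd.mpr hc).symm.map
      (Int.castRingHom (𝓞 K))
  refine ⟨c * x, hcR x, Ideal.span {(c : 𝓞 K)} * E, ?_, ?_⟩
  · rw [← Ideal.span_singleton_mul_span_singleton, hxE, mul_left_comm]
  · exact ((Ideal.isCoprime_span_singleton_iff _ _).mpr hcp).mul_left (hsplit ▸ hE)

end QuadraticField

section Lattices

variable {K : Type*} [Field K] {v w : Fin 2 → K}

lemma map_mul_mulVec (M N : Matrix (Fin 2) (Fin 2) ℤ) (v : Fin 2 → K) :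
    (M * N).map (Int.cast : ℤ → K) *ᵥ v =
      M.map (Int.cast : ℤ → K) *ᵥ (N.map (Int.cast : ℤ → K) *ᵥ v) := by
  rw [Matrix.mulVec_mulVec]
  exact congrArg (· *ᵥ v) (Matrix.map_mul (f := Int.castRingHom K))

lemma map_natCast_mulVec (n : ℕ) (v : Fin 2 → K) :
    (n : Matrix (Fin 2) (Fin 2) ℤ).map (Int.cast : ℤ → K) *ᵥ v = (n : K) • v := by
  ext i
  simp [Matrix.mulVec, dotProduct, Matrix.natCast_apply]

lemma map_mulVec_mem_span (M : Matrix (Fin 2) (Fin 2) ℤ) (v : Fin 2 → K) (i : Fin 2) :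
    (M.map (Int.cast : ℤ → K) *ᵥ v) i ∈ Submodule.span ℤ (Set.range v) :=
  (Submodule.mem_span_range_iff_exists_fun ℤ).mpr ⟨M i, by simp [Matrix.mulVec, dotProduct]⟩

lemma exists_eq_map_mulVec (h : ∀ i, w i ∈ Submodule.span ℤ (Set.range v)) :
    ∃ M : Matrix (Fin 2) (Fin 2) ℤ, w = M.map (Int.cast : ℤ → K) *ᵥ v := by
  choose M hM using fun i => (Submodule.mem_span_range_iff_exists_fun ℤ).mp (h i)
  refine ⟨Matrix.of M, funext fun i => ?_⟩
  rw [← hM i]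
  simp [Matrix.mulVec, dotProduct]

lemma mul_mem_span_of_smul_eq {s a : K} {M : Matrix (Fin 2) (Fin 2) ℤ}
    (hs : s • v = M.map (Int.cast : ℤ → K) *ᵥ w) (ha : a ∈ Submodule.span ℤ (Set.range v)) :
    s * a ∈ Submodule.span ℤ (Set.range w) := by
  obtain ⟨c, rfl⟩ := (Submodule.mem_span_range_iff_exists_fun ℤ).mp ha
  rw [Finset.mul_sum]
  refine Submodule.sum_mem _ fun i _ => ?_
  have hsi : s * v i = (M.map (Int.cast : ℤ → K) *ᵥ w) i := congrFun hs i
  rw [mul_smul_comm, hsi]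
  exact Submodule.smul_mem _ _ (map_mulVec_mem_span M w i)

lemma eq_of_map_mulVec_eq (hv : LinearIndependent ℤ v) {M N : Matrix (Fin 2) (Fin 2) ℤ}
    (h : M.map (Int.cast : ℤ → K) *ᵥ v = N.map (Int.cast : ℤ → K) *ᵥ v) : M = N := by
  ext i k
  refine sub_eq_zero.mp (Fintype.linearIndependent_iff.mp hv (fun k => M i k - N i k) ?_ k)
  have hi := congrFun h i
  simp only [Matrix.mulVec, dotProduct, Fin.sum_univ_two, Matrix.map_apply] at hi
  simp only [Fin.sum_univ_two, zsmul_eq_mul, Int.cast_sub]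
  linear_combination hi

lemma linearIndependent_map_mulVec (hv : LinearIndependent ℤ v)
    {P : Matrix (Fin 2) (Fin 2) ℤ} (hP : P.det ≠ 0) :
    LinearIndependent ℤ (P.map (Int.cast : ℤ → K) *ᵥ v) := by
  rw [Fintype.linearIndependent_iff]
  intro g hg
  have hgP : g ᵥ* P = 0 := by
    refine funext (Fintype.linearIndependent_iff.mp hv (g ᵥ* P) ?_)
    rw [← hg]
    simp only [Matrix.vecMul, Matrix.mulVec, dotProduct, Fin.sum_univ_two, zsmul_eq_mul,
      Matrix.map_apply]
    push_cast
    ring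
  exact congrFun (Matrix.eq_zero_of_vecMul_eq_zero hP hgP)

lemma natAbs_det_eq_absNorm [NumberField K] (hK : Module.finrank ℚ K = 2)
    (hv : LinearIndependent ℤ v) {l : 𝓞 K} {A : Matrix (Fin 2) (Fin 2) ℤ}
    (hA : (l : K) • v = A.map (Int.cast : ℤ → K) *ᵥ v) :
    A.det.natAbs = Ideal.absNorm (Ideal.span {l}) := by
  let b := basisOfLinearIndependentOfCardEqFinrank
    ((LinearIndependent.iff_fractionRing ℤ ℚ).mp hv) (by rw [hK, Fintype.card_fin])
  have hb (i : Fin 2) : b i = v i := by rw [coe_basisOfLinearIndependentOfCardEqFinrank]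
  have hmat : Algebra.leftMulMatrix b (l : K) = (A.map (Int.cast : ℤ → ℚ))ᵀ := by
    ext i k
    have hlb : (l : K) * b k = ∑ m, (A k m : ℚ) • b m := by
      have hk := congrFun hA k
      simp only [Pi.smul_apply, smul_eq_mul, Matrix.mulVec, dotProduct, Matrix.map_apply] at hk
      simp only [hb, hk, Fin.sum_univ_two, Algebra.smul_def, map_intCast]
    rw [Algebra.leftMulMatrix_eq_repr_mul, hlb, b.repr_sum_self, Matrix.transpose_apply,
      Matrix.map_apply]
  have hdet : (Algebra.norm ℤ l : ℚ) = A.det := by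
    rw [Algebra.coe_norm_int, Algebra.norm_eq_matrix_det b, hmat, Matrix.det_transpose]
    exact (Int.castRingHom ℚ).map_det A |>.symm
  rw [Ideal.absNorm_span_singleton, Int.cast_injective hdet]

variable {R : Subalgebra ℤ (𝓞 K)} {𝔞 : Submodule R K} {p : ℕ} {𝔭 : Ideal (𝓞 K)}

lemma IsBasisOf.mem_iff (hv : IsBasisOf v 𝔞) {x : K} :
    x ∈ 𝔞 ↔ x ∈ Submodule.span ℤ (Set.range v) :=
  (Set.ext_iff.mp hv.2 x).symm

lemma IsBasisOf.apply_mem (hv : IsBasisOf v 𝔞) (i : Fin 2) : v i ∈ 𝔞 :=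
  hv.mem_iff.mpr (Submodule.subset_span ⟨i, rfl⟩)

lemma mem_idealIn_smul_iff {l : 𝓞 K} (hlR : l ∈ R) (hl : l ∈ 𝔭) (hp : (p : 𝓞 K) ∈ 𝔭)
    (hgen : ∀ x ∈ R, x ∈ 𝔭 → ∃ y ∈ R, ∃ z ∈ R, x = l * y + p * z) (x : K) :
    x ∈ idealIn R 𝔭 • 𝔞 ↔ ∃ a ∈ 𝔞, ∃ b ∈ 𝔞, x = (l : K) * a + p * b := by
  have smul_def (r : R) (m : K) : r • m = algebraMap (𝓞 K) K r * m := rfl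
  constructor
  · intro hx
    induction hx using Submodule.smul_induction_on' with
    | smul r hr m hm =>
      obtain ⟨y, hy, z, hz, hr⟩ := hgen r r.2 hr
      refine ⟨_, 𝔞.smul_mem ⟨y, hy⟩ hm, _, 𝔞.smul_mem ⟨z, hz⟩ hm, ?_⟩
      simp only [smul_def, hr, map_add, map_mul, map_natCast]
      ring
    | add x _ y _ hx hy =>
      obtain ⟨a, ha, b, hb, rfl⟩ := hx
      obtain ⟨a', ha', b', hb', rfl⟩ := hy
      exact ⟨_, 𝔞.add_mem ha ha', _, 𝔞.add_mem hb hb', by ring⟩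
  · rintro ⟨a, ha, b, hb, rfl⟩
    have hpb := Submodule.smul_mem_smul (I := idealIn R 𝔭) (N := 𝔞)
      (r := ⟨p, natCast_mem R p⟩) hp hb
    rw [smul_def, map_natCast] at hpb
    exact add_mem (Submodule.smul_mem_smul (r := (⟨l, hlR⟩ : R)) hl ha) hpb

lemma IsTransition.unique (hp : p ≠ 0) (hv : LinearIndependent ℤ v)
    {P P' : Matrix (Fin 2) (Fin 2) ℤ} (h : IsTransition p v 𝔞 𝔭 P)
    (h' : IsTransition p v 𝔞 𝔭 P') : ∃ M : SL(2, ℤ), P' = (M : Matrix (Fin 2) (Fin 2) ℤ) * P := by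
  obtain ⟨M, hM⟩ := exists_eq_map_mulVec fun i => h.2.mem_iff.mp (h'.2.apply_mem i)
  rw [← map_mul_mulVec] at hM
  have hPM := eq_of_map_mulVec_eq hv hM
  have hdet := congrArg Matrix.det hPM
  rw [Matrix.det_mul, h.1, h'.1] at hdet
  exact ⟨⟨M, (mul_eq_right₀ (Nat.cast_ne_zero.mpr hp)).mp hdet.symm⟩, hPM⟩

end Lattices

section RightDivisors

lemma span_singleton_eq_span_pair {O : Type*} [Ring O] {P A B C D U V : O} (hA : C * P = A)
    (hB : D * P = B) (hP : U * A + V * B = P) : Ideal.span {P} = Ideal.span {A, B} := by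
  refine le_antisymm ?_ (Ideal.span_le.mpr ?_)
  · exact (Ideal.span_singleton_le_iff_mem _).mpr (Submodule.mem_span_pair.mpr ⟨U, V, hP⟩)
  · rintro _ (rfl | rfl)
    exacts [Ideal.mem_span_singleton'.mpr ⟨C, hA⟩, Ideal.mem_span_singleton'.mpr ⟨D, hB⟩]

lemma exists_det_eq_prime_and_span_eq_of_upper_triangular {p n a d : ℕ} (hp : p.Prime)
    (hn : ¬ p ∣ n) (had : a * d = p * n) (b : ℤ) : ∃ P : Matrix (Fin 2) (Fin 2) ℤ, P.det = p ∧
      Ideal.span {P} = Ideal.span {!![(a : ℤ), b; 0, (d : ℤ)], (p : Matrix (Fin 2) (Fin 2) ℤ)} := by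
  have bezout {m : ℕ} (hm : ¬ p ∣ m) : ∃ s t : ℤ, s * m + t * p = 1 :=
    ((hp.coprime_iff_not_dvd.mpr hm).symm.cast : IsCoprime (m : ℤ) p)
  rcases hp.dvd_mul.mp (Dvd.intro n had.symm) with ⟨a', rfl⟩ | ⟨d', rfl⟩
  · have hd : a' * d = n := Nat.eq_of_mul_eq_mul_left hp.pos (by rw [← had]; ring)
    obtain ⟨s, t, hst⟩ := bezout fun h => hn (hd ▸ h.mul_left a')
    refine ⟨!![(p : ℤ), 0; 0, 1], by simp, span_singleton_eq_span_pair
      (C := !![(a' : ℤ), b; 0, d]) (D := !![1, 0; 0, (p : ℤ)]) (U := !![0, 0; 0, s])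
      (V := !![1, 0; 0, t]) ?_ ?_ ?_⟩ <;>
    · ext i k
      fin_cases i <;> fin_cases k <;> simp [Matrix.mul_apply, Matrix.natCast_apply] <;> linarith
  · have ha : a * d' = n := Nat.eq_of_mul_eq_mul_left hp.pos (by rw [← had]; ring)
    obtain ⟨s, t, hst⟩ := bezout fun h => hn (ha ▸ h.mul_right d')
    refine ⟨!![1, s * b; 0, (p : ℤ)], by simp, span_singleton_eq_span_pair
      (C := !![(a : ℤ), b * t; 0, d']) (D := !![(p : ℤ), -s * b; 0, 1]) (U := !![s, 0; 0, 0])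
      (V := !![t, 0; 0, 1]) ?_ ?_ ?_⟩ <;>
    · ext i k
      fin_cases i <;> fin_cases k <;> simp [Matrix.mul_apply, Matrix.natCast_apply] <;> grind

/-- A greatest common right divisor of `A` and `p`. -/
lemma exists_det_eq_prime_and_span_eq {p n : ℕ} (hp : p.Prime) (hn : ¬ p ∣ n)
    {A : Matrix (Fin 2) (Fin 2) ℤ} (hA : A.det = (p * n : ℕ)) :
    ∃ P : Matrix (Fin 2) (Fin 2) ℤ, P.det = p ∧
      Ideal.span {P} = Ideal.span {A, (p : Matrix (Fin 2) (Fin 2) ℤ)} := by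
  have : NeZero (p * n) := ⟨mul_ne_zero hp.ne_zero fun h => hn (h ▸ dvd_zero p)⟩
  obtain ⟨γ, a, d, b, -, -, had, hγA⟩ := exists_smul_eq_upper_triangular ⟨A, hA⟩
  replace hγA : (γ : Matrix (Fin 2) (Fin 2) ℤ) * A = !![(a : ℤ), b; 0, (d : ℤ)] := hγA
  obtain ⟨P, hP, hspan⟩ := exists_det_eq_prime_and_span_eq_of_upper_triangular hp hn had b
  refine ⟨P, hP, hspan.trans ?_⟩
  have hγ : IsUnit (γ : Matrix (Fin 2) (Fin 2) ℤ) :=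
    (Matrix.isUnit_iff_isUnit_det _).mpr (by rw [γ.det_coe]; exact isUnit_one)
  rw [← hγA, Ideal.span_insert, Ideal.span_insert, Ideal.span_singleton_mul_left_unit hγ]

end RightDivisors

section Multipliers

variable {K : Type*} [Field K] {p : ℕ} {𝔭 : Ideal (𝓞 K)} {R : Subalgebra ℤ (𝓞 K)}
  {𝔞 : Submodule R K} {v : Fin 2 → K}

/-- Complex multiplication by `l` on the ideal `𝔞` of the order `R`: `A` is its matrix for the
basis `v`, one has `(l) = 𝔭 𝔢` with `𝔢` prime to `p`, and `𝔞 𝔭_R = l 𝔞 + p 𝔞`. The determinant of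
`A` is written `p n`, up to sign. -/
structure IsMultiplier (p : ℕ) (𝔭 : Ideal (𝓞 K)) (𝔞 : Submodule R K) (v : Fin 2 → K) (l : 𝓞 K)
    (𝔢 : Ideal (𝓞 K)) (n : ℕ) (A : Matrix (Fin 2) (Fin 2) ℤ) : Prop where
  span_eq : Ideal.span {l} = 𝔭 * 𝔢
  isCoprime : IsCoprime 𝔢 (Ideal.span {(p : 𝓞 K)})
  not_dvd : ¬ p ∣ n
  natAbs_det : A.det.natAbs = p * n
  smul_eq : (l : K) • v = A.map (Int.cast : ℤ → K) *ᵥ v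
  mem_iff : ∀ x, x ∈ idealIn R 𝔭 • 𝔞 ↔ ∃ a ∈ 𝔞, ∃ b ∈ 𝔞, x = (l : K) * a + p * b

lemma exists_isMultiplier [NumberField K] (hK : Module.finrank ℚ K = 2) (hp : p.Prime)
    (h𝔭 : 𝔭.IsMaximal) {𝔭bar : Ideal (𝓞 K)} (h𝔭bar : 𝔭bar.IsMaximal)
    (hsplit : 𝔭 * 𝔭bar = Ideal.span {(p : 𝓞 K)})
    (hcond : ¬ Ideal.span {(p : 𝓞 K)} ∣ conductor R) (hv : IsBasisOf v 𝔞) :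
    ∃ l 𝔢 n A, IsMultiplier p 𝔭 𝔞 v l 𝔢 n A := by
  obtain ⟨c, hc, hcR⟩ := exists_intCast_mem_conductor hK hcond
  obtain ⟨l, hlR, 𝔢, hl, hcop⟩ := exists_mem_span_singleton_eq_mul hp h𝔭 h𝔭bar hsplit hc hcR
  obtain ⟨A, hA⟩ := exists_eq_map_mulVec (v := v) (w := (l : K) • v) fun i =>
    hv.mem_iff.mp (𝔞.smul_mem (⟨l, hlR⟩ : R) (hv.apply_mem i))
  have hl𝔭 : l ∈ 𝔭 := Ideal.mul_le_left (hl ▸ Ideal.mem_span_singleton_self l)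
  have hp𝔭 : (p : 𝓞 K) ∈ 𝔭 := Ideal.mul_le_left (hsplit ▸ Ideal.mem_span_singleton_self (p : 𝓞 K))
  exact ⟨l, 𝔢, Ideal.absNorm 𝔢, A,
    { span_eq := hl
      isCoprime := hcop
      not_dvd := not_dvd_absNorm_of_isCoprime hp hcop
      natAbs_det := by
        rw [natAbs_det_eq_absNorm hK hv.1 hA, hl, map_mul,
          absNorm_eq_of_mul_eq hK hp h𝔭.ne_top h𝔭bar.ne_top hsplit]
      smul_eq := hA
      mem_iff := mem_idealIn_smul_iff hlR hl𝔭 hp𝔭 fun _ hxR hx =>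
        exists_eq_mul_add_natCast_mul hp hsplit hc hcR hl hcop hxR hx }⟩

variable {l : 𝓞 K} {𝔢 : Ideal (𝓞 K)} {n : ℕ} {A : Matrix (Fin 2) (Fin 2) ℤ}

lemma IsMultiplier.pos (h : IsMultiplier p 𝔭 𝔞 v l 𝔢 n A) : 0 < n :=
  Nat.pos_of_ne_zero fun hn => h.not_dvd (hn ▸ dvd_zero p)

lemma IsMultiplier.exists_isTransition (h : IsMultiplier p 𝔭 𝔞 v l 𝔢 n A) (hp : p.Prime)
    (hA : A.det = (p * n : ℕ)) (hv : IsBasisOf v 𝔞) : ∃ P, IsTransition p v 𝔞 𝔭 P := by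
  obtain ⟨P, hP, hspan⟩ := exists_det_eq_prime_and_span_eq hp h.not_dvd hA
  obtain ⟨C, rfl⟩ : ∃ C, C * P = A :=
    Ideal.mem_span_singleton'.mp (hspan ▸ Ideal.subset_span (Set.mem_insert A _))
  obtain ⟨D, hD⟩ : ∃ D, D * P = (p : Matrix (Fin 2) (Fin 2) ℤ) :=
    Ideal.mem_span_singleton'.mp (hspan ▸ Ideal.subset_span (Set.mem_insert_of_mem _ rfl))
  obtain ⟨U, V, hUV⟩ : ∃ U V, U * (C * P) + V * (p : Matrix (Fin 2) (Fin 2) ℤ) = P :=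
    Submodule.mem_span_pair.mp (hspan ▸ Ideal.mem_span_singleton_self P)
  have hlv := h.smul_eq
  have hpv := (map_natCast_mulVec p v).symm
  have hPv : P.map (Int.cast : ℤ → K) *ᵥ v = (l : K) • (U.map (Int.cast : ℤ → K) *ᵥ v) +
      (p : K) • (V.map (Int.cast : ℤ → K) *ᵥ v) := by
    conv_lhs => rw [← hUV]
    rw [Matrix.map_add _ Int.cast_add, Matrix.add_mulVec, map_mul_mulVec, ← hlv, map_mul_mulVec,
      ← hpv, Matrix.mulVec_smul, Matrix.mulVec_smul]
  rw [map_mul_mulVec] at hlv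
  rw [← hD, map_mul_mulVec] at hpv
  have mem (M : Matrix (Fin 2) (Fin 2) ℤ) (i : Fin 2) : (M.map (Int.cast : ℤ → K) *ᵥ v) i ∈ 𝔞 :=
    hv.mem_iff.mpr (map_mulVec_mem_span M v i)
  refine ⟨P, hP, linearIndependent_map_mulVec hv.1 (hP ▸ Nat.cast_ne_zero.mpr hp.ne_zero),
    Set.Subset.antisymm (Submodule.span_le (p := (idealIn R 𝔭 • 𝔞).restrictScalars ℤ) |>.mpr ?_) ?_⟩
  · rintro _ ⟨i, rfl⟩
    exact (h.mem_iff _).mpr ⟨_, mem U i, _, mem V i, congrFun hPv i⟩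
  · intro x hx
    obtain ⟨a, ha, b, hb, rfl⟩ := (h.mem_iff x).mp hx
    exact add_mem (mul_mem_span_of_smul_eq hlv (hv.mem_iff.mp ha))
      (mul_mem_span_of_smul_eq hpv (hv.mem_iff.mp hb))

lemma IsMultiplier.exists_eq_mul (h : IsMultiplier p 𝔭 𝔞 v l 𝔢 n A) (hp : p.Prime)
    (hA : A.det = (p * n : ℕ)) (hv : IsBasisOf v 𝔞) {P : Matrix (Fin 2) (Fin 2) ℤ}
    (hP : IsTransition p v 𝔞 𝔭 P) : ∃ C : Matrix (Fin 2) (Fin 2) ℤ, C.det = n ∧ A = C * P := by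
  obtain ⟨C, hC⟩ := exists_eq_map_mulVec (v := P.map (Int.cast : ℤ → K) *ᵥ v)
    (w := (l : K) • v) fun i => hP.2.mem_iff.mp
      ((h.mem_iff _).mpr ⟨v i, hv.apply_mem i, 0, zero_mem _, by simp⟩)
  rw [← map_mul_mulVec, h.smul_eq] at hC
  have hAC := eq_of_map_mulVec_eq hv.1 hC
  refine ⟨C, mul_right_cancel₀ (b := (p : ℤ)) (Nat.cast_ne_zero.mpr hp.ne_zero) ?_, hAC⟩
  rw [← hP.1, ← Matrix.det_mul, ← hAC, hA, hP.1, Nat.cast_mul, mul_comm]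

end Multipliers

section EigenvectorEvaluation

variable {A : Matrix (Fin 2) (Fin 2) ℤ} {z : ℍ} {l : ℂ}

lemma det_eq_normSq_of_eigen (h0 : l * z = (A 0 0 : ℂ) * z + A 0 1)
    (h1 : l = automorphyFactor A z) : (A.det : ℝ) = Complex.normSq l := by
  rw [automorphyFactor] at h1
  have h0' := congrArg (starRingEnd ℂ) h0
  have h1' := congrArg (starRingEnd ℂ) h1
  simp only [map_mul, map_add, map_intCast] at h0' h1'
  have hz : (z : ℂ) - starRingEnd ℂ z ≠ 0 := by
    simpa [Complex.sub_conj] using z.im_ne_zero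
  have hdet : (A.det : ℂ) = l * starRingEnd ℂ l := by
    refine mul_right_cancel₀ hz ?_
    rw [Matrix.det_fin_two]
    push_cast
    linear_combination (-starRingEnd ℂ l) * h0 + l * h0' +
      ((A 0 0 : ℂ) * starRingEnd ℂ z + A 0 1) * h1 - ((A 0 0 : ℂ) * z + A 0 1) * h1'
  rw [Complex.mul_conj] at hdet
  exact Complex.ofReal_injective ((Complex.ofReal_intCast _).trans hdet)

lemma moebius_eq_self_of_eigen (hA : 0 < A.det) (h0 : l * z = (A 0 0 : ℂ) * z + A 0 1)
    (h1 : l = automorphyFactor A z) : moebius A z = z := by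
  have hl : l ≠ 0 := h1 ▸ automorphyFactor_ne_zero hA z
  rw [automorphyFactor] at h1
  ext
  rw [coe_moebius A hA, ← h0, ← h1, mul_div_cancel_left₀ _ hl]

lemma phi_mul_pow_of_eigen (hA : 0 < A.det) (h0 : l * z = (A 0 0 : ℂ) * z + A 0 1)
    (h1 : l = automorphyFactor A z) : phi A z * l ^ 12 = (A.det : ℂ) ^ 12 := by
  have hl : automorphyFactor A z ≠ 0 := automorphyFactor_ne_zero hA z
  have hdisc := ModularForm.discriminant_ne_zero z
  rw [phi_eq hA, moebius_eq_self_of_eigen hA h0 h1, h1]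
  field_simp

end EigenvectorEvaluation

lemma not_isSquare_prime_mul {p n : ℕ} (hp : p.Prime) (hn : ¬ p ∣ n) : ¬ IsSquare (p * n) := by
  rintro ⟨k, hk⟩
  obtain ⟨r, rfl⟩ : p ∣ k := or_self_iff.mp (hp.dvd_mul.mp (Dvd.intro n hk))
  exact hn ⟨r * r, Nat.eq_of_mul_eq_mul_left hp.pos (hk.trans (by ring))⟩

section SingularValues

variable {K : IntermediateField ℚ ℂ} {p : ℕ} {𝔭 𝔭bar : Ideal (𝓞 K)} {R : Subalgebra ℤ (𝓞 K)}
  {𝔞 : Submodule R K} {v : Fin 2 → K} {l : 𝓞 K} {𝔢 : Ideal (𝓞 K)} {n : ℕ}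
  {A : Matrix (Fin 2) (Fin 2) ℤ} {α : ℍ}

lemma map_mul_map_eq_span_natCast (hsplit : 𝔭 * 𝔭bar = Ideal.span {(p : 𝓞 K)}) :
    𝔭.map (algebraMap (𝓞 K) (𝓞 ℂ)) * 𝔭bar.map (algebraMap (𝓞 K) (𝓞 ℂ)) =
      Ideal.span {(p : 𝓞 ℂ)} := by
  rw [← Ideal.map_mul, hsplit, Ideal.map_span, Set.image_singleton, map_natCast]

namespace IsMultiplier

lemma eigen (h : IsMultiplier p 𝔭 𝔞 v l 𝔢 n A) (hv : IsBasisOf v 𝔞)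
    (hα : (α : ℂ) = (v 0 : ℂ) / (v 1 : ℂ)) :
    ((l : K) : ℂ) * α = (A 0 0 : ℂ) * α + A 0 1 ∧ ((l : K) : ℂ) = automorphyFactor A α := by
  have hv1 : (v 1 : ℂ) ≠ 0 := mod_cast hv.1.ne_zero 1
  have smul_apply (i : Fin 2) : ((l : K) : ℂ) * v i = (A i 0 : ℂ) * v 0 + A i 1 * v 1 := by
    have hi := congrFun h.smul_eq i
    simp only [Matrix.mulVec, dotProduct, Fin.sum_univ_two, Matrix.map_apply, smul_eq_mul,
      Pi.smul_apply] at hi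
    exact_mod_cast congrArg (fun x : K => (x : ℂ)) hi
  rw [automorphyFactor, hα]
  constructor <;> field_simp
  exacts [(smul_apply 0).trans (by ring), (smul_apply 1).trans (by ring)]

lemma det_eq (h : IsMultiplier p 𝔭 𝔞 v l 𝔢 n A) (hv : IsBasisOf v 𝔞)
    (hα : (α : ℂ) = (v 0 : ℂ) / (v 1 : ℂ)) : A.det = (p * n : ℕ) := by
  have hnonneg : (0 : ℝ) ≤ A.det :=
    det_eq_normSq_of_eigen (h.eigen hv hα).1 (h.eigen hv hα).2 ▸ Complex.normSq_nonneg _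
  rw [← h.natAbs_det, Int.natAbs_of_nonneg (Int.cast_nonneg_iff.mp hnonneg)]

lemma det_pos (h : IsMultiplier p 𝔭 𝔞 v l 𝔢 n A) (hp : p.Prime) (hv : IsBasisOf v 𝔞)
    (hα : (α : ℂ) = (v 0 : ℂ) / (v 1 : ℂ)) : 0 < A.det := by
  rw [h.det_eq hv hα]
  exact Nat.cast_pos.mpr (Nat.mul_pos hp.pos h.pos)

lemma isIntegral_j (h : IsMultiplier p 𝔭 𝔞 v l 𝔢 n A) (hp : p.Prime) (hv : IsBasisOf v 𝔞)
    (hα : (α : ℂ) = (v 0 : ℂ) / (v 1 : ℂ)) : IsIntegral ℤ (j α) :=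
  isIntegral_j_of_moebius_eq (not_isSquare_prime_mul hp h.not_dvd) (h.det_eq hv hα)
    (moebius_eq_self_of_eigen (h.det_pos hp hv hα) (h.eigen hv hα).1 (h.eigen hv hα).2)

lemma exists_mul_mul_pow_eq (h : IsMultiplier p 𝔭 𝔞 v l 𝔢 n A) (hp : p.Prime)
    (hv : IsBasisOf v 𝔞) (hα : (α : ℂ) = (v 0 : ℂ) / (v 1 : ℂ))
    {P : Matrix (Fin 2) (Fin 2) ℤ} (hP : IsTransition p v 𝔞 𝔭 P) :
    ∃ x y : 𝓞 ℂ, (x : ℂ) = phi P α ∧ x ∣ (p : 𝓞 ℂ) ^ 12 ∧ y ∣ (n : 𝓞 ℂ) ^ 12 ∧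
      x * y * algebraMap (𝓞 K) (𝓞 ℂ) l ^ 12 = (p : 𝓞 ℂ) ^ 12 * (n : 𝓞 ℂ) ^ 12 := by
  have : NeZero p := ⟨hp.ne_zero⟩
  have : NeZero n := ⟨h.pos.ne'⟩
  have hA := h.det_eq hv hα
  obtain ⟨C, hC, rfl⟩ := h.exists_eq_mul hp hA hv hP
  have hjα := h.isIntegral_j hp hv hα
  obtain ⟨x, x', hx, hxx'⟩ := exists_eq_phi_and_mul_eq hP.1 hjα
  obtain ⟨y, y', hy, hyy'⟩ := exists_eq_phi_and_mul_eq hC (isIntegral_j_moebius hP.1 hjα)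
  refine ⟨x, y, hx, Dvd.intro _ hxx', Dvd.intro _ hyy', NumberField.RingOfIntegers.ext ?_⟩
  have hphi : phi (C * P) α * ((l : K) : ℂ) ^ 12 = _ :=
    phi_mul_pow_of_eigen (h.det_pos hp hv hα) (h.eigen hv hα).1 (h.eigen hv hα).2
  rw [phi_mul (hC ▸ Nat.cast_pos.mpr h.pos) (hP.1 ▸ Nat.cast_pos.mpr hp.pos), hA, ← hx, ← hy]
    at hphi
  push_cast at hphi ⊢
  rw [← mul_pow, ← hphi, mul_comm (x : ℂ)]
  rfl

theorem generatesSameDivisor (h : IsMultiplier p 𝔭 𝔞 v l 𝔢 n A) (hp : p.Prime)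
    (hsplit : 𝔭 * 𝔭bar = Ideal.span {(p : 𝓞 K)}) (hv : IsBasisOf v 𝔞)
    (hα : (α : ℂ) = (v 0 : ℂ) / (v 1 : ℂ)) {P : Matrix (Fin 2) (Fin 2) ℤ}
    (hP : IsTransition p v 𝔞 𝔭 P) : GeneratesSameDivisor (phi P α) (𝔭bar ^ 12) := by
  obtain ⟨x, y, hx, hxp, hyn, hxy⟩ := h.exists_mul_mul_pow_eq hp hv hα hP
  have map_span (a : 𝓞 K) : (Ideal.span {a}).map (algebraMap (𝓞 K) (𝓞 ℂ)) =
      Ideal.span {algebraMap (𝓞 K) (𝓞 ℂ) a} := by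
    rw [Ideal.map_span, Set.image_singleton]
  have hcop : IsCoprime (𝔢.map (algebraMap (𝓞 K) (𝓞 ℂ))) (Ideal.span {(p : 𝓞 ℂ)}) := by
    simpa only [Ideal.mapHom_apply, map_span, map_natCast] using
      h.isCoprime.map (Ideal.mapHom (algebraMap (𝓞 K) (𝓞 ℂ)))
  have hnp : IsCoprime (n : 𝓞 ℂ) p := (hp.coprime_iff_not_dvd.mpr h.not_dvd).symm.cast
  refine ⟨x, hx, ?_⟩
  rw [Ideal.map_pow]
  exact span_singleton_eq_pow (Nat.cast_ne_zero.mpr hp.ne_zero) (map_mul_map_eq_span_natCast hsplit)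
    (by rw [← map_span, h.span_eq, Ideal.map_mul]) hcop hnp hxp hyn hxy

end IsMultiplier

theorem isAlgebraic_and_divisibleBy (hp : p.Prime) (h𝔭 : 𝔭.IsMaximal) (h𝔭bar : 𝔭bar.IsMaximal)
    (hsplit : 𝔭 * 𝔭bar = Ideal.span {(p : 𝓞 K)}) (hne : 𝔭 ≠ 𝔭bar) (hα : IsIntegral ℤ (j α))
    {P : Matrix (Fin 2) (Fin 2) ℤ} {f : ℍ → ℂ} (hP : P.det = p) (hf : IsEntireIntegral p P f)
    (hdvd : ∀ g, IsConjugate P f !![(p : ℤ), 0; 0, 1] g → ∃ a : ℤ → ℂ, HasQExpansion 1 g a ∧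
      ∀ ν, ∃ c : ℂ, IsIntegral ℤ c ∧ a ν = p * c)
    {P' : Matrix (Fin 2) (Fin 2) ℤ} (hP' : P'.det = p) {g : ℍ → ℂ} (hg : IsConjugate P f P' g)
    (hphi : GeneratesSameDivisor (phi P' α) (𝔭 ^ 12)) :
    IsAlgebraic ℚ (g α) ∧ DivisibleBy (g α) 𝔭 := by
  obtain ⟨x, y, w, r, hx, hxy, hw, hwy⟩ :=
    IsEntireIntegral.exists_mul_eq (P := ⟨P, hP⟩) (P' := ⟨P', hP'⟩) hp hf hdvd hg hα
  obtain ⟨x', hx', hspan⟩ := hphi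
  obtain rfl : x' = x := NumberField.RingOfIntegers.ext (hx'.trans hx.symm)
  rw [Ideal.map_pow] at hspan
  have hcop := (Ideal.isCoprime_of_isMaximal hne).map (Ideal.mapHom (algebraMap (𝓞 K) (𝓞 ℂ)))
  have hint : IsIntegral ℤ (g α) := hw ▸ w.isIntegral_coe
  exact ⟨hint.tower_top.isAlgebraic, w, hw, mem_of_mul_eq_mul_of_isCoprime
    (Nat.cast_ne_zero.mpr hp.ne_zero) (map_mul_map_eq_span_natCast hsplit) hcop hspan hxy hwy⟩

end SingularValues

end CM

end

theorem mainTheorem6 (p : ℕ) (hp : p.Prime)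
    (K : IntermediateField ℚ ℂ) (hK : Module.finrank ℚ K = 2)
    (𝔭 𝔭bar : Ideal (𝓞 K)) (h𝔭 : 𝔭.IsPrime) (h𝔭bar : 𝔭bar.IsPrime)
    (hsplit : 𝔭 * 𝔭bar = Ideal.span {(p : 𝓞 K)})
    (R : Subalgebra ℤ (𝓞 K)) (hR : CM.IsOrder R)
    (hcond : ¬ Ideal.span {(p : 𝓞 K)} ∣ CM.conductor R)
    (𝔞 : Submodule R K) (v : Fin 2 → K) (hv : CM.IsBasisOf v 𝔞)
    (α : UpperHalfPlane) (hα : (α : ℂ) = (v 0 : ℂ) / (v 1 : ℂ)) :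
    -- the matrix `P_𝔭` exists and is unique up to equivalence, and `φ_{P_𝔭}(α) ≈ 𝔭bar¹²`
    (∃ P, CM.IsTransition p v 𝔞 𝔭 P) ∧
    (∀ P P', CM.IsTransition p v 𝔞 𝔭 P → CM.IsTransition p v 𝔞 𝔭 P' →
      ∃ M : SL(2, ℤ), P' = (M : Matrix (Fin 2) (Fin 2) ℤ) * P) ∧
    (∀ P, CM.IsTransition p v 𝔞 𝔭 P → CM.GeneratesSameDivisor (CM.phi P α) (𝔭bar ^ 12)) ∧
    -- if `𝔭 ≠ 𝔭bar`, then `f_{P_𝔭bar}(α)` is algebraic and divisible by `𝔭`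
    (𝔭 ≠ 𝔭bar → ∀ (P : Matrix (Fin 2) (Fin 2) ℤ) (f : UpperHalfPlane → ℂ),
      P.det = p → CM.IsEntireIntegral p P f →
      (∀ g, CM.IsConjugate P f !![(p : ℤ), 0; 0, 1] g →
        ∃ a : ℤ → ℂ, CM.HasQExpansion 1 g a ∧
          ∀ ν, ∃ c : ℂ, IsIntegral ℤ c ∧ a ν = p * c) →
      ∀ P' g, CM.IsTransition p v 𝔞 𝔭bar P' → CM.IsConjugate P f P' g →
        IsAlgebraic ℚ (g α) ∧ CM.DivisibleBy (g α) 𝔭) := by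
  have : Module.Finite ℚ K := Module.finite_of_finrank_pos (hK ▸ two_pos)
  have : NumberField K := ⟨⟩
  have hsplit' : 𝔭bar * 𝔭 = Ideal.span {(p : 𝓞 K)} := (mul_comm _ _).trans hsplit
  have hbot : 𝔭 * 𝔭bar ≠ ⊥ := by
    rw [hsplit, Ne, Ideal.span_singleton_eq_bot]
    exact Nat.cast_ne_zero.mpr hp.ne_zero
  have hmax : 𝔭.IsMaximal := h𝔭.isMaximal (left_ne_zero_of_mul hbot)
  have hmax' : 𝔭bar.IsMaximal := h𝔭bar.isMaximal (right_ne_zero_of_mul hbot)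
  obtain ⟨l, 𝔢, n, A, h⟩ := CM.exists_isMultiplier hK hp hmax hmax' hsplit hcond hv
  obtain ⟨l', 𝔢', n', A', h'⟩ := CM.exists_isMultiplier hK hp hmax' hmax hsplit' hcond hv
  refine ⟨h.exists_isTransition hp (h.det_eq hv hα) hv,
    fun P P' hP hP' => hP.unique hp.ne_zero hv.1 hP',
    fun P hP => h.generatesSameDivisor hp hsplit hv hα hP,
    fun hne P f hP hf hdvd P' g hP' hg => ?_⟩
  exact CM.isAlgebraic_and_divisibleBy hp hmax hmax' hsplit hne (h.isIntegral_j hp hv hα) hP hf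
    hdvd hP'.1 hg (h'.generatesSameDivisor hp hsplit' hv hα hP')
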